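/- **Setting.** There are $L$ base arms, a finite action set $\mathcal A\subseteq 2^{[L]}$ of batches with $|A|\le K$ for all $A\in\mathcal A$, where $K\ge 2$, and every arm lies in some batch. In each round $t=1,2,\dots$ a feedback matrix $X(t)=(X_{ij}(t))_{i\in[M],j\in[L]}$ with entries in $[0,1]$ is drawn, i.i.d. over the rounds from a fixed unknown law (its entries may be arbitrarily dependent), and $p_{ij}=\mathbb E[X_{ij}(t)]$. An agent that plays $A_t\in\mathcal A$ observes $X_{ij}(t)$ for all $j\in A_t$ and $i\in[M]$. The reward is $r(A;p)=\sum_{i=1}^M w_i r_i(A;p_i)$ with $w_i\ge 0$, $\bar M=\sum_i w_i$, and functions $r_i\ge 0$ on $\mathcal A\times[0,1]^L$ that are monotonic Gini-smooth with parameters $\gamma_\infty,\gamma_g$: for every $A\in\mathcal A$, $f=r_i(A;\cdot)$ is continuous on $[0,1]^L$ and differentiable on $(0,1)^L$, and for all $x\in(0,1)^L$ $$0\le \tfrac{\partial f}{\partial x_j}(x)\le\gamma_\infty\ (j\in A),\qquad \tfrac{\partial f}{\partial x_j}(x)=0\ (j\notin A),\qquad \sqrt{\sum_{j=1}^L x_j(1-x_j)\Big(\tfrac{\partial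 f}{\partial x_j}(x)\Big)^2}\le\gamma_g .$$ **Algorithm.** Let $\alpha,\beta\in[0,1]$. An $(\alpha,\beta)$-approximation oracle is a randomized map that for every parameter matrix $q\in[0,1]^{M\times L}$ outputs a batch $A\in\mathcal A$ with $\Pr\{r(A;q)\ge\alpha\max_{A'\in\mathcal A}r(A';q)\}\ge\beta$. Let $N_j(t)$ be the number of rounds $\tau\le t$ with $j\in A_\tau$, and let $\hat p_{ij}(t)$ and $\hat V_{ij}(t)$ be the empirical mean and the empirical variance (normalized by $N_j(t)$) of the observed values $X_{ij}(\tau)$, $\tau\le t$, $j\in A_\tau$. In round $t$, BC-UCB plays a batch containing some arm $j$ with $N_j(t-1)=0$ if there is such an arm; otherwise it plays the output of the oracle, called with fresh randomness, on $$q_{ij}(t)=\min\Big\{1,\ \hat p_{ij}(t-1)+\sqrt{\tfrac{6\hat V_{ij}(t-1)\log t}{N_j(t-1)}}+\tfrac{9\log t}{N_j(t-1)}\Big\}.$$ **Regret.** Let $r_{\max}=\max_{A\in\mathcal A}r(A;p)$, $\Delta_A=\alpha r_{\max}-r(A;p)$, and $R(T)=\alpha\beta\, r_{\max}T-\sum_{t=1}^T\mathbb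 E[r(A_t;p)]$. Let $\Delta_{j,\min}$ and $\Delta_{j,\max}$ be the smallest and the largest positive $\Delta_A$ over the batches $A\ni j$, and let $\Delta_{\max}$ be the largest positive $\Delta_A$ over all $A\in\mathcal A$ (and $0$ if there is none). **Theorem.** For every $T\ge 1$, the expected approximation regret of BC-UCB run with an $(\alpha,\beta)$-approximation oracle satisfies $$R(T)\le\Big[8640\,\gamma_g^2\bar M^2\sum_{j}\frac1{\Delta_{j,\min}}+340\,\gamma_\infty\bar M\sum_{j}\Big(1+\log\frac{\Delta_{j,\max}}{\Delta_{j,\min}}\Big)\Big]\Big\lceil\frac{\log K}{1.61}\Big\rceil^2\log T+L\,\Delta_{\max}\Big(1+\frac{2\pi^2}{3}M\Big),$$ where the sums run over the arms $j\in[L]$ that lie in at least one batch with a positive gap (the other arms contribute $0$). -/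

import Mathlib

open MeasureTheory ProbabilityTheory

/-- The open unit cube `(0,1)^L`. -/
def openCube (L : ℕ) : Set (Fin L → ℝ) := {x | ∀ j, x j ∈ Set.Ioo (0 : ℝ) 1}

/-- The closed unit cube `[0,1]^L`. -/
def closedCube (L : ℕ) : Set (Fin L → ℝ) := {x | ∀ j, x j ∈ Set.Icc (0 : ℝ) 1}

/-- The partial derivative `∂f/∂x_j` at `x`. -/
noncomputable def partialDeriv {L : ℕ} (f : (Fin L → ℝ) → ℝ) (j : Fin L) (x : Fin L → ℝ) : ℝ :=
  fderiv ℝ f x (Pi.single j 1)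

/-- `f(A; x)` is monotonic Gini-smooth over the action set `𝒜`, with smoothness parameters
`γinf` and `γg`. Nothing is required of `f(A; ·)` outside the closed unit cube. -/
structure MonotonicGiniSmooth {L : ℕ} {𝒜 : Finset (Finset (Fin L))}
    (f : 𝒜 → (Fin L → ℝ) → ℝ) (γinf γg : ℝ) : Prop where
  differentiable : ∀ A, ∀ x ∈ openCube L, DifferentiableAt ℝ (f A) x
  continuous : ∀ A, ContinuousOn (f A) (closedCube L)
  deriv_mem : ∀ A : 𝒜, ∀ j ∈ A.1, ∀ x ∈ openCube L,
    0 ≤ partialDeriv (f A) j x ∧ partialDeriv (f A) j x ≤ γinf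
  deriv_not_mem : ∀ A : 𝒜, ∀ j ∉ A.1, ∀ x ∈ openCube L, partialDeriv (f A) j x = 0
  gini : ∀ A, ∀ x ∈ openCube L,
    √(∑ j, x j * (1 - x j) * partialDeriv (f A) j x ^ 2) ≤ γg

/-- The data of a combinatorial semi-bandit problem with `L` base arms whose reward is a weighted
sum of `M` functions: the action set, the weights `w i`, the functions `r i (A; x)`, and the law
of the feedback matrix `(X i j)` drawn afresh in every round (its entries may be arbitrarily
dependent). -/
structure SemiBandit (L M : ℕ) where
  actions : Finset (Finset (Fin L))
  w : Fin M → ℝ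
  r : Fin M → actions → (Fin L → ℝ) → ℝ
  law : Measure (Fin M → Fin L → ℝ)

namespace SemiBandit

variable {L M : ℕ} (P : SemiBandit L M)

/-- The mean parameters `p i j = E[X i j]`. -/
noncomputable def mean (i : Fin M) (j : Fin L) : ℝ := ∫ x, x i j ∂P.law

/-- The reward `r(A; q) = ∑ i, w i * r i (A; q i)`. -/
noncomputable def reward (A : P.actions) (q : Fin M → Fin L → ℝ) : ℝ :=
  ∑ i, P.w i * P.r i A (q i)

/-- The optimal value for the parameters `q`: the largest reward of a batch. -/
noncomputable def optValue (q : Fin M → Fin L → ℝ) : ℝ := ⨆ A : P.actions, P.reward A q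

/-- `r_max`, the optimal value for the true parameters. -/
noncomputable def rMax : ℝ := P.optValue P.mean

/-- The total weight `∑ i, w i`. -/
def totalWeight : ℝ := ∑ i, P.w i

/-- The suboptimality gap `Δ_A = α r_max - r(A; p)`. -/
noncomputable def gap (α : ℝ) (A : P.actions) : ℝ := α * P.rMax - P.reward A P.mean

/-- The batches that contain the arm `j` and have a positive gap. -/
def badBatches (α : ℝ) (j : Fin L) : Set P.actions := {A | j ∈ A.1 ∧ 0 < P.gap α A}

open Classical in
/-- The arms that lie in some batch with a positive gap. These are the arms `j` for which
`Δ_{j,min}` and `Δ_{j,max}` exist. -/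
noncomputable def badArms (α : ℝ) : Finset (Fin L) :=
  Finset.univ.filter fun j => (P.badBatches α j).Nonempty

/-- `Δ_{j,min}`, the smallest positive gap of a batch containing `j` (for `j` in `badArms`). -/
noncomputable def gapMin (α : ℝ) (j : Fin L) : ℝ := sInf (P.gap α '' P.badBatches α j)

/-- `Δ_{j,max}`, the largest positive gap of a batch containing `j` (for `j` in `badArms`). -/
noncomputable def gapMax (α : ℝ) (j : Fin L) : ℝ := sSup (P.gap α '' P.badBatches α j)

/-- `Δ_max`, the largest positive gap of a batch, and `0` if no batch has a positive gap. If all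
batches are nonempty this is the largest `Δ_{j,max}`. -/
noncomputable def maxGap (α : ℝ) : ℝ := sSup (P.gap α '' {A | 0 < P.gap α A})

/-- A randomized oracle, which maps parameters to the distribution of its output batch, is an
`(α, β)`-approximation oracle if, for all parameters in `[0,1]`, with probability at least `β` it
outputs a batch of value at least `α` times the optimal value. -/
def IsApproxOracle (α β : ℝ) (oracle : (Fin M → Fin L → ℝ) → PMF P.actions) : Prop :=
  ∀ q : Fin M → Fin L → ℝ, (∀ i, q i ∈ closedCube L) →
    ENNReal.ofReal β ≤ (oracle q).toOuterMeasure {A | α * P.optValue q ≤ P.reward A q}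

section Statistics

/-! Statistics of a sequence `a 1, a 2, …` of batches and `x 1, x 2, …` of feedback matrices. They
use the entry `x τ i j` only if `j ∈ a τ`. -/

variable {P} (a : ℕ → P.actions) (x : ℕ → Fin M → Fin L → ℝ)

/-- `N_j(t)`: how often the arm `j` was played in the rounds `1, …, t`. -/
def count (j : Fin L) (t : ℕ) : ℕ := ((Finset.Icc 1 t).filter fun τ => j ∈ (a τ).1).card

/-- The empirical mean of the observed feedback up to round `t`. -/
noncomputable def empMean (i : Fin M) (j : Fin L) (t : ℕ) : ℝ :=
  1 / (count a j t : ℝ) * ∑ τ ∈ (Finset.Icc 1 t).filter (fun τ => j ∈ (a τ).1), x τ i j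

/-- The empirical variance of the observed feedback up to round `t`. -/
noncomputable def empVar (i : Fin M) (j : Fin L) (t : ℕ) : ℝ :=
  1 / (count a j t : ℝ) * ∑ τ ∈ (Finset.Icc 1 t).filter (fun τ => j ∈ (a τ).1), x τ i j ^ 2
    - empMean a x i j t ^ 2

/-- The Empirical-Bernstein index `q_ij(t)` (used when `N_j(t-1) > 0` for all `j`). -/
noncomputable def ucbIndex (t : ℕ) (i : Fin M) (j : Fin L) : ℝ :=
  min 1 (empMean a x i j (t - 1)
    + √(6 * empVar a x i j (t - 1) * Real.log t / (count a j (t - 1) : ℝ))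
    + 9 * Real.log t / (count a j (t - 1) : ℝ))

end Statistics

/-- The σ-algebra of the rounds before round `t`: generated by the batches `A s` and the feedback
matrices `X s` for `1 ≤ s < t`. -/
abbrev past {P : SemiBandit L M} {Ω : Type*} (A : ℕ → Ω → P.actions)
    (X : ℕ → Ω → Fin M → Fin L → ℝ) (t : ℕ) : MeasurableSpace Ω :=
  ⨆ s ∈ Finset.Ico 1 t,
    (MeasurableSpace.comap (X s) inferInstance ⊔ MeasurableSpace.comap (A s) ⊤)

/-- `T` rounds `1, …, T` of BC-UCB with the given oracle on the problem `P`, where `A t` is the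
batch and `X t` the feedback matrix of round `t`:
* `X t` has the law of the environment and is independent of the earlier rounds and of `A t`;
* while some arm has not been played, the batch contains such an arm;
* otherwise the batch is drawn by the oracle, called with the indices `q(t)`: conditionally on the
  earlier rounds, `A t` has the distribution `oracle (q(t))`. -/
structure IsBCUCB {Ω : Type*} [MeasurableSpace Ω] (μ : Measure Ω)
    (oracle : (Fin M → Fin L → ℝ) → PMF P.actions) (T : ℕ)
    (A : ℕ → Ω → P.actions) (X : ℕ → Ω → Fin M → Fin L → ℝ) : Prop where
  measurable_batch : ∀ t ∈ Finset.Icc 1 T, ∀ B, MeasurableSet (A t ⁻¹' {B})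
  measurable_feedback : ∀ t ∈ Finset.Icc 1 T, Measurable (X t)
  law_feedback : ∀ t ∈ Finset.Icc 1 T, μ.map (X t) = P.law
  indep_feedback : ∀ t ∈ Finset.Icc 1 T,
    Indep (MeasurableSpace.comap (X t) inferInstance)
      (past A X t ⊔ MeasurableSpace.comap (A t) ⊤) μ
  initial : ∀ t ∈ Finset.Icc 1 T, ∀ᵐ ω ∂μ,
    (∃ j, count (fun s => A s ω) j (t - 1) = 0) →
      ∃ j, count (fun s => A s ω) j (t - 1) = 0 ∧ j ∈ (A t ω).1
  oracle_step : ∀ t ∈ Finset.Icc 1 T, ∀ B, ∀ᵐ ω ∂μ,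
    (∀ j, count (fun s => A s ω) j (t - 1) ≠ 0) →
      (μ[(A t ⁻¹' {B}).indicator (fun _ => (1 : ℝ)) | past A X t]) ω
        = (oracle (ucbIndex (fun s => A s ω) (fun s => X s ω) t) B).toReal

/-- The expected approximation regret `R(T) = α β r_max T - ∑_{t ≤ T} E[r(A_t; p)]`. -/
noncomputable def regret {Ω : Type*} [MeasurableSpace Ω] (μ : Measure Ω) (α β : ℝ)
    (A : ℕ → Ω → P.actions) (T : ℕ) : ℝ :=
  α * β * P.rMax * T - ∑ t ∈ Finset.Icc 1 T, ∫ ω, P.reward (A t ω) P.mean ∂μ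

end SemiBandit

/-! Put x_j = sin² θ_j. Since dx_j/dθ_j = 2√(x_j(1-x_j)), the Gini condition bounds the gradient in
the angles θ_j = arcsin √x_j by 2γg, so each r_i(A;·) is 2γg-Lipschitz in them
(`MonotonicGiniSmooth.sub_le_arcsin`). A good index has width of order √(p(1-p))·ε + ε² with ε² =
log t / N_j; measured in the angle this is of order ε, whatever p is (`arcsin_sqrt_sub_le`).

In a round where all indices are good and the oracle succeeds, optimism and monotonicity bound the
gap by r(A;q) - r(A;p). Hence Δ_A² ≤ g ∑_{j∈A} 1/N_j with g = (9π M̄ γg)² log T (`gap_sq_le`). Such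
a gap can be charged to the arms of the batch: with a = 2g/Δ_{j,min}², arm j pays
Δ_{j,min}·min(√(a/N_j), a/N_j), and nothing once N_j > K a (`gap_le_sum_armCharge`). Over all its
plays an arm pays at most Δ_{j,min}·a(3 + log K) (`sum_armCharge_le`). This already fits under the
γg term of the bound; the γinf term only has to be nonnegative.

An index is good when four deviation inequalities hold: upper and lower ones for the empirical mean
and for the empirical second moment about p. The number of observations is random and depends on the
data, so Chernoff's method is applied to an exponential supermartingale for each value n of N_j,
with a union over n. The exponent 3 log t leaves failure probability 4/t² per index, which is
summable and gives 2π²/3. At most L rounds are initial. Failures of the oracle cost nothing, because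
the benchmark carries the factor β and rewards are nonnegative (`IsBCUCB.round_regret_le`). -/

/-! ### Gini-smooth functions in angular coordinates -/

/-- The mean value theorem along the path whose coordinates are `sin² θ` with `θ` affine. -/
theorem exists_openCube_sub_eq {L : ℕ} {f : (Fin L → ℝ) → ℝ}
    (hf : ∀ x ∈ openCube L, DifferentiableAt ℝ f x) {x y : Fin L → ℝ}
    (hx : x ∈ openCube L) (hy : y ∈ openCube L) :
    ∃ z ∈ openCube L, f y - f x = ∑ j, 2 * √(z j * (1 - z j))
      * (Real.arcsin √(y j) - Real.arcsin √(x j)) * partialDeriv f j z := by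
  have key : ∀ u ∈ Set.Ioo (0 : ℝ) 1, Real.arcsin √u ∈ Set.Ioo 0 (Real.pi / 2) := by
    intro u hu
    have h1 : 0 < √u := Real.sqrt_pos.2 hu.1
    have h2 : √u < 1 := by rw [Real.sqrt_lt' one_pos]; simpa using hu.2
    exact ⟨Real.arcsin_pos.2 h1, Real.arcsin_lt_pi_div_two.2 h2⟩
  have sinsq : ∀ u ∈ Set.Ioo (0 : ℝ) 1, Real.sin (Real.arcsin √u) ^ 2 = u := by
    intro u hu
    have h2 : √u < 1 := by rw [Real.sqrt_lt' one_pos]; simpa using hu.2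
    rw [Real.sin_arcsin (by linarith [Real.sqrt_nonneg u]) h2.le, Real.sq_sqrt hu.1.le]
  set D : Fin L → ℝ := fun j => Real.arcsin √(y j) - Real.arcsin √(x j) with hD
  set θ : ℝ → Fin L → ℝ := fun s j => Real.arcsin √(x j) + s * D j with hθ
  -- The angles stay in the convex interval (0, π/2), so the path never leaves the open cube, where
  -- differentiability is available.
  have hθmem : ∀ s ∈ Set.Icc (0 : ℝ) 1, ∀ j, θ s j ∈ Set.Ioo 0 (Real.pi / 2) := by
    intro s hs j
    have hc := (convex_Ioo (0 : ℝ) (Real.pi / 2)) (key _ (hx j)) (key _ (hy j))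
      (by linarith [hs.2] : (0 : ℝ) ≤ 1 - s) hs.1 (by ring)
    have : θ s j = (1 - s) • Real.arcsin √(x j) + s • Real.arcsin √(y j) := by
      simp only [hθ, hD, smul_eq_mul]; ring
    rw [this]; exact hc
  set g : ℝ → Fin L → ℝ := fun s j => Real.sin (θ s j) ^ 2 with hg
  have hgmem : ∀ s ∈ Set.Icc (0 : ℝ) 1, g s ∈ openCube L := by
    intro s hs j
    have h := hθmem s hs j
    have h1 : 0 < Real.sin (θ s j) :=
      Real.sin_pos_of_pos_of_lt_pi h.1 (by linarith [h.2, Real.pi_pos])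
    have h2 : 0 < Real.cos (θ s j) :=
      Real.cos_pos_of_mem_Ioo ⟨by linarith [h.1, Real.pi_pos], h.2⟩
    refine ⟨by positivity, ?_⟩
    have := Real.sin_sq_add_cos_sq (θ s j)
    simp only [hg]
    nlinarith [sq_pos_of_pos h2]
  have hgder : ∀ s, HasDerivAt g
      (fun j => 2 * Real.sin (θ s j) * Real.cos (θ s j) * D j) s := by
    intro s
    rw [hasDerivAt_pi]
    intro j
    have h1 : HasDerivAt (fun s => θ s j) (D j) s := by
      simpa [hθ] using ((hasDerivAt_id s).mul_const (D j)).const_add (Real.arcsin √(x j))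
    have h2 := (h1.sin).pow 2
    exact h2.congr_deriv (by push_cast; ring)
  have hcomp : ∀ s ∈ Set.Icc (0 : ℝ) 1, HasDerivAt (fun s => f (g s))
      (∑ j, 2 * Real.sin (θ s j) * Real.cos (θ s j) * D j * partialDeriv f j (g s)) s := by
    intro s hs
    have h := (hf _ (hgmem s hs)).hasFDerivAt.comp_hasDerivAt s (hgder s)
    refine h.congr_deriv ?_
    rw [← ContinuousLinearMap.coe_coe, LinearMap.pi_apply_eq_sum_univ]
    refine Finset.sum_congr rfl fun j _ => ?_
    simp only [smul_eq_mul, partialDeriv, ContinuousLinearMap.coe_coe]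
    congr 2
    ext k
    simp [Pi.single_apply, eq_comm]
  obtain ⟨s, hs, hseq⟩ := exists_hasDerivAt_eq_slope (fun s => f (g s)) _ zero_lt_one
    (fun s hs => (hcomp s hs).continuousAt.continuousWithinAt)
    (fun s hs => hcomp s (Set.Ioo_subset_Icc_self hs))
  have hs' := Set.Ioo_subset_Icc_self hs
  refine ⟨g s, hgmem s hs', ?_⟩
  have g0 : g 0 = x := by ext j; simp [hg, hθ, sinsq _ (hx j)]
  have g1 : g 1 = y := by ext j; simp [hg, hθ, hD, sinsq _ (hy j)]
  simp only [g0, g1, sub_zero, div_one] at hseq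
  rw [← hseq]
  refine Finset.sum_congr rfl fun j _ => ?_
  have h := hθmem s hs' j
  have h1 : 0 < Real.sin (θ s j) :=
    Real.sin_pos_of_pos_of_lt_pi h.1 (by linarith [h.2, Real.pi_pos])
  have h2 : 0 < Real.cos (θ s j) :=
    Real.cos_pos_of_mem_Ioo ⟨by linarith [h.1, Real.pi_pos], h.2⟩
  -- The speed 2 sin θ cos θ of sin² θ is twice the Gini weight √(z(1-z)); this is why this path is
  -- used.
  have h3 : √(g s j * (1 - g s j)) = Real.sin (θ s j) * Real.cos (θ s j) := by
    rw [Real.sqrt_eq_iff_mul_self_eq_of_pos (by positivity)]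
    have := Real.sin_sq_add_cos_sq (θ s j)
    have h4 : 1 - g s j = Real.cos (θ s j) ^ 2 := by simp only [hg]; linarith
    rw [h4]; simp only [hg]; ring
  rw [h3]; ring

/-- Contracting slightly towards the centre of the cube moves boundary points inside, so that
estimates on the open cube extend to the closed cube by continuity. -/
theorem shrink_mem_openCube {L : ℕ} {x : Fin L → ℝ} (hx : x ∈ closedCube L) {u : ℝ}
    (hu : u ∈ Set.Ioo (0 : ℝ) 1) : (fun j => x j + u * (1 / 2 - x j)) ∈ openCube L := by
  intro j
  have h := hx j
  constructor
  · nlinarith [mul_nonneg (sub_nonneg.2 hu.2.le) h.1, hu.1]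
  · nlinarith [mul_nonneg (sub_nonneg.2 hu.2.le) (sub_nonneg.2 h.2), hu.1]

theorem tendsto_shrink {L : ℕ} {x : Fin L → ℝ} (hx : x ∈ closedCube L) :
    Filter.Tendsto (fun u : ℝ => (fun j => x j + u * (1 / 2 - x j) : Fin L → ℝ))
      (nhdsWithin 0 (Set.Ioo 0 1)) (nhdsWithin x (closedCube L)) := by
  rw [tendsto_nhdsWithin_iff]
  constructor
  · have : Continuous (fun u : ℝ => (fun j => x j + u * (1 / 2 - x j) : Fin L → ℝ)) := by
      fun_prop
    have h := this.tendsto 0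
    simp only [zero_mul, add_zero] at h
    exact h.mono_left nhdsWithin_le_nhds
  · filter_upwards [self_mem_nhdsWithin] with u hu
    intro j
    exact Set.Ioo_subset_Icc_self (shrink_mem_openCube hx hu j)

instance neBot_nhdsWithin_Ioo_zero_one : (nhdsWithin (0 : ℝ) (Set.Ioo 0 1)).NeBot :=
  left_nhdsWithin_Ioo_neBot zero_lt_one

namespace MonotonicGiniSmooth

variable {L : ℕ} {𝒜 : Finset (Finset (Fin L))} {f : 𝒜 → (Fin L → ℝ) → ℝ} {γinf γg : ℝ}

/-- A monotonic Gini-smooth function is Lipschitz in the angles `arcsin √(x j)`. -/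
theorem sub_le_arcsin (hf : MonotonicGiniSmooth f γinf γg) (A : 𝒜) {x y : Fin L → ℝ}
    (hx : x ∈ closedCube L) (hy : y ∈ closedCube L) :
    f A y - f A x
      ≤ 2 * γg * √(∑ j ∈ A.1, (Real.arcsin √(y j) - Real.arcsin √(x j)) ^ 2) := by
  have hopen : ∀ x ∈ openCube L, ∀ y ∈ openCube L, f A y - f A x
      ≤ 2 * γg * √(∑ j ∈ A.1, (Real.arcsin √(y j) - Real.arcsin √(x j)) ^ 2) := by
    intro x hx y hy
    obtain ⟨z, hz, h⟩ := exists_openCube_sub_eq (hf.differentiable A) hx hy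
    have h1 : ∑ j, 2 * √(z j * (1 - z j))
        * (Real.arcsin √(y j) - Real.arcsin √(x j)) * partialDeriv (f A) j z
        = 2 * ∑ j ∈ A.1, (Real.arcsin √(y j) - Real.arcsin √(x j))
          * (√(z j * (1 - z j)) * partialDeriv (f A) j z) := by
      rw [Finset.mul_sum]
      symm
      rw [← Finset.sum_subset (Finset.subset_univ A.1)]
      · exact Finset.sum_congr rfl fun j _ => by ring
      · intro j _ hj
        rw [hf.deriv_not_mem A j hj z hz, mul_zero]
    -- Cauchy–Schwarz: one factor is the distance in the angles, the other is the Gini norm at the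
    -- intermediate point.
    have h2 := Real.sum_mul_le_sqrt_mul_sqrt A.1
      (fun j => Real.arcsin √(y j) - Real.arcsin √(x j))
      (fun j => √(z j * (1 - z j)) * partialDeriv (f A) j z)
    have hnn : ∀ j, 0 ≤ z j * (1 - z j) := fun j =>
      mul_nonneg (hz j).1.le (by linarith [(hz j).2])
    have h3 : √(∑ j ∈ A.1, (√(z j * (1 - z j)) * partialDeriv (f A) j z) ^ 2) ≤ γg := by
      refine le_trans (Real.sqrt_le_sqrt ?_) (hf.gini A z hz)
      have : ∀ j, (√(z j * (1 - z j)) * partialDeriv (f A) j z) ^ 2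
          = z j * (1 - z j) * partialDeriv (f A) j z ^ 2 := fun j => by
        rw [mul_pow, Real.sq_sqrt (hnn j)]
      simp only [this]
      exact Finset.sum_le_sum_of_subset_of_nonneg (Finset.subset_univ _)
        fun j _ _ => mul_nonneg (hnn j) (sq_nonneg _)
    rw [h, h1]
    have h4 := mul_le_mul_of_nonneg_left h3
      (Real.sqrt_nonneg (∑ j ∈ A.1, (Real.arcsin √(y j) - Real.arcsin √(x j)) ^ 2))
    linarith
  have tx := (hf.continuous A x hx).tendsto.comp (tendsto_shrink hx)
  have ty := (hf.continuous A y hy).tendsto.comp (tendsto_shrink hy)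
  have tc : Filter.Tendsto (fun u : ℝ => 2 * γg * √(∑ j ∈ A.1,
      (Real.arcsin √(y j + u * (1 / 2 - y j)) - Real.arcsin √(x j + u * (1 / 2 - x j))) ^ 2))
      (nhdsWithin 0 (Set.Ioo 0 1))
      (nhds (2 * γg * √(∑ j ∈ A.1, (Real.arcsin √(y j) - Real.arcsin √(x j)) ^ 2))) := by
    have hc : Continuous (fun u : ℝ => 2 * γg * √(∑ j ∈ A.1,
      (Real.arcsin √(y j + u * (1 / 2 - y j)) - Real.arcsin √(x j + u * (1 / 2 - x j))) ^ 2)) := by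
      have := Real.continuous_arcsin
      fun_prop
    have h := hc.tendsto 0
    simp only [zero_mul, add_zero] at h
    exact h.mono_left nhdsWithin_le_nhds
  refine le_of_tendsto_of_tendsto (ty.sub tx) tc ?_
  filter_upwards [self_mem_nhdsWithin] with u hu
  exact hopen _ (shrink_mem_openCube hx hu) _ (shrink_mem_openCube hy hu)

/-- All terms of the mean value formula are nonnegative, since the angle is an increasing function
of the coordinate; the boundary is again reached by continuity. -/
theorem mono (hf : MonotonicGiniSmooth f γinf γg) (A : 𝒜) {x y : Fin L → ℝ}
    (hx : x ∈ closedCube L) (hy : y ∈ closedCube L) (hxy : ∀ j, x j ≤ y j) :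
    f A x ≤ f A y := by
  have hopen : ∀ x ∈ openCube L, ∀ y ∈ openCube L, (∀ j, x j ≤ y j) → f A x ≤ f A y := by
    intro x hx y hy hxy
    obtain ⟨z, hz, h⟩ := exists_openCube_sub_eq (hf.differentiable A) hx hy
    rw [← sub_nonneg, h]
    refine Finset.sum_nonneg fun j _ => mul_nonneg (mul_nonneg (by positivity) ?_) ?_
    · exact sub_nonneg.2 (Real.monotone_arcsin (Real.sqrt_le_sqrt (hxy j)))
    · by_cases hj : j ∈ A.1
      · exact (hf.deriv_mem A j hj z hz).1
      · rw [hf.deriv_not_mem A j hj z hz]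
  have tx := (hf.continuous A x hx).tendsto.comp (tendsto_shrink hx)
  have ty := (hf.continuous A y hy).tendsto.comp (tendsto_shrink hy)
  refine le_of_tendsto_of_tendsto tx ty ?_
  filter_upwards [self_mem_nhdsWithin] with u hu
  refine hopen _ (shrink_mem_openCube hx hu) _ (shrink_mem_openCube hy hu) fun j => ?_
  nlinarith [mul_nonneg (sub_nonneg.2 hu.2.le) (sub_nonneg.2 (hxy j))]

end MonotonicGiniSmooth

/-! ### Deterministic bounds for the Empirical-Bernstein index -/

/-- A Bernstein-type bound on `q - p` bounds the difference of the angles `arcsin √·`. -/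
theorem arcsin_sqrt_sub_le {p q ε : ℝ} (hp : 0 ≤ p) (hq : q ≤ 1) (hpq : p ≤ q) (hε : 0 ≤ ε)
    (h : q - p ≤ 2 * √6 * √(p * (1 - p)) * ε + 13 * ε ^ 2) :
    Real.arcsin √q - Real.arcsin √p ≤ 9 * Real.pi / 2 * ε := by
  set D := Real.arcsin √q - Real.arcsin √p with hD
  have hq0 : 0 ≤ q := hp.trans hpq
  have hp1 : p ≤ 1 := hpq.trans hq
  have hD0 : 0 ≤ D := sub_nonneg.2 (Real.monotone_arcsin (Real.sqrt_le_sqrt hpq))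
  have hD1 : D ≤ Real.pi / 2 := by
    have h1 := Real.arcsin_le_pi_div_two √q
    have h2 : 0 ≤ Real.arcsin √p := Real.arcsin_nonneg.2 (Real.sqrt_nonneg _)
    linarith
  have hsin : Real.sin D = √q * √(1 - p) - √(1 - q) * √p := by
    have a1 : ∀ u : ℝ, 0 ≤ u → u ≤ 1 → Real.sin (Real.arcsin √u) = √u := fun u h0 h1 =>
      Real.sin_arcsin (by linarith [Real.sqrt_nonneg u]) (Real.sqrt_le_one.2 h1)
    rw [hD, Real.sin_sub, a1 q hq0 hq, a1 p hp hp1, Real.cos_arcsin, Real.cos_arcsin,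
      Real.sq_sqrt hq0, Real.sq_sqrt hp]
  -- Jordan's inequality on [0, π/2] reduces the claim to a bound on sin D, at the price of the
  -- factor π/2.
  have hjordan : D ≤ Real.pi / 2 * Real.sin D := by
    have := Real.mul_le_sin hD0 hD1
    have h2 := mul_le_mul_of_nonneg_left this (by positivity : 0 ≤ Real.pi / 2)
    have : Real.pi / 2 * (2 / Real.pi * D) = D := by field_simp
    linarith
  suffices hs : Real.sin D ≤ 9 * ε by
    have := mul_le_mul_of_nonneg_left hs (by positivity : 0 ≤ Real.pi / 2)
    linarith
  set S := √(q * (1 - p)) with hS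
  set R := √((1 - q) * p) with hR
  have hsinSR : Real.sin D = S - R := by
    rw [hsin, hS, hR, Real.sqrt_mul hq0, Real.sqrt_mul (by linarith)]
  have hS0 : 0 ≤ S := Real.sqrt_nonneg _
  have hR0 : 0 ≤ R := Real.sqrt_nonneg _
  have hS2 : S ^ 2 = q * (1 - p) := Real.sq_sqrt (mul_nonneg hq0 (by linarith))
  have hR2 : R ^ 2 = (1 - q) * p := Real.sq_sqrt (mul_nonneg (by linarith) hp)
  -- This is q(1-p) - (1-q)p = q - p. As R ≥ 0, it bounds sin D = S - R by (q-p)/S.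
  have hprod : (S - R) * (S + R) = q - p := by nlinarith
  have hSv : √(p * (1 - p)) ≤ S := Real.sqrt_le_sqrt (by nlinarith)
  have hSd : q - p ≤ 2 * S ^ 2 := by
    rw [hS2]
    rcases le_total p (1 / 2) with hc | hc
    · nlinarith
    · nlinarith
  have h6 : √6 ≤ 2.45 := by rw [Real.sqrt_le_left (by norm_num)]; norm_num
  have hx0 : 0 ≤ Real.sin D := Real.sin_nonneg_of_nonneg_of_le_pi hD0 (by linarith [Real.pi_pos])
  by_contra! hcon
  rw [hsinSR] at hcon hx0
  set x := S - R with hx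
  have hxS : x * S ≤ q - p := by nlinarith
  have hb : q - p ≤ 4.9 * ε * S + 13 * ε ^ 2 := by
    have : √6 * √(p * (1 - p)) ≤ 2.45 * S := mul_le_mul h6 hSv (Real.sqrt_nonneg _) (by norm_num)
    nlinarith
  have hxpos : 0 < x := by linarith
  have hSpos : 0 < S := by linarith
  have h2S : x ≤ 2 * S := by
    linarith
  have : x * S ≤ 4.9 * ε * S + 13 * ε ^ 2 := hxS.trans hb
  -- With ε < x/9 and x ≤ 2S the right side is at most (4.9/9 + 26/81)·xS, which is less than xS.
  nlinarith [mul_pos hxpos hSpos, mul_nonneg hε hS0, mul_nonneg hε hε]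

/-- The deterministic core of the Empirical-Bernstein bound: lower deviation bounds for the
empirical mean and for the empirical second moment around the mean give optimism. Here `d` is the
deviation of the mean, and `V` is the empirical variance. -/
theorem empirical_bernstein_le {σ ε d V : ℝ} (hσ : 0 ≤ σ) (hσ' : σ ≤ 1 / 2) (hε : 0 < ε)
    (h1 : d ≤ √6 * σ * ε + ε ^ 2) (h2 : σ ^ 2 ≤ V + √6 * σ * ε + d ^ 2) :
    d ≤ √6 * √V * ε + 9 * ε ^ 2 := by
  have h6 : √6 ≤ 2.45 := by rw [Real.sqrt_le_left (by norm_num)]; norm_num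
  have h6' : 2.449 ≤ √6 := Real.le_sqrt_of_sq_le (by norm_num)
  have h6s : √6 ^ 2 = 6 := Real.sq_sqrt (by norm_num)
  by_contra! hcon
  set y := √V with hy
  have hy0 : 0 ≤ y := Real.sqrt_nonneg _
  have hyV : V ≤ y ^ 2 := by
    rcases le_total 0 V with h | h
    · rw [hy, Real.sq_sqrt h]
    · exact h.trans (sq_nonneg _)
  -- The two bounds on d are compared and divided by ε. Since 8/√6 > 3.265, this gives `a2`, and
  -- then σ ≤ 1/2 forces ε ≤ 0.1532.
  have a1 : √6 * y + 8 * ε < √6 * σ := by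
    have : (√6 * y + 8 * ε) * ε < √6 * σ * ε := by nlinarith
    exact lt_of_mul_lt_mul_right this hε.le
  have a2 : y + 3.265 * ε < σ := by nlinarith
  have hd0 : 0 ≤ d := by
    have : 0 ≤ √6 * y * ε := by positivity
    nlinarith [sq_nonneg ε]
  have a3 : ε ≤ 0.1532 := by nlinarith [mul_nonneg (Real.sqrt_nonneg 6) hy0]
  have a4 : d ≤ 1.3783 * ε := by
    have b1 : √6 * σ ≤ 1.225 := by nlinarith
    have b2 := mul_le_mul_of_nonneg_right b1 hε.le
    have b3 := mul_le_mul_of_nonneg_right a3 hε.le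
    nlinarith
  have a5 : d ^ 2 ≤ 1.9 * ε ^ 2 := by
    have := pow_le_pow_left₀ hd0 a4 2
    nlinarith [sq_nonneg ε]
  -- Inserted in `h2`, this leaves (6.53 - 2.45)·σε ≤ (3.265² + 1.9)·ε², which contradicts σε ≥
  -- 3.265 ε².
  have a7 : y ^ 2 ≤ (σ - 3.265 * ε) ^ 2 := pow_le_pow_left₀ hy0 (by linarith) 2
  have a8 : √6 * σ * ε ≤ 2.45 * (σ * ε) := by
    have := mul_le_mul_of_nonneg_right h6 (mul_nonneg hσ hε.le)
    linarith
  have a9 : 3.265 * ε ^ 2 ≤ σ * ε := by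
    have := mul_le_mul_of_nonneg_right (by linarith : 3.265 * ε ≤ σ) hε.le
    linarith
  have a10 : 0 < ε ^ 2 := by positivity
  linarith

/-- The deterministic bound on the width of the Empirical-Bernstein index. -/
theorem empirical_bernstein_width {σ ε d V : ℝ} (hσ : 0 ≤ σ) (hε : 0 ≤ ε)
    (h1 : d ≤ √6 * σ * ε + ε ^ 2) (h2 : V ≤ σ ^ 2 + √6 * σ * ε + ε ^ 2) :
    d + √6 * √V * ε + 9 * ε ^ 2 ≤ 2 * √6 * σ * ε + 13 * ε ^ 2 := by
  have h6s : √6 ^ 2 = 6 := Real.sq_sqrt (by norm_num)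
  have h60 : 0 ≤ √6 := Real.sqrt_nonneg _
  -- The square of the right side is σ² + √6 σε + 1.5 ε². Multiplied by √6 ε, the term √6/2·ε
  -- becomes 3ε², whence 1 + 3 + 9 = 13.
  have hV : √V ≤ σ + √6 / 2 * ε := by
    rw [Real.sqrt_le_left (by positivity)]
    nlinarith [sq_nonneg ε]
  have := mul_le_mul_of_nonneg_right (mul_le_mul_of_nonneg_left hV h60) hε
  nlinarith

/-! ### Exponential moments -/

/-- The Bernstein bound for the exponential function. -/
theorem exp_sub_one_sub_le_of_nonneg {u : ℝ} (hu : 0 ≤ u) :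
    (1 - u / 3) * (Real.exp u - 1 - u) ≤ u ^ 2 / 2 := by
  have hd1 : ∀ x : ℝ, HasDerivAt (fun u => u ^ 2 / 2 - (1 - u / 3) * (Real.exp u - 1 - u))
      (x + 1 / 3 * (Real.exp x - 1 - x) - (1 - x / 3) * (Real.exp x - 1)) x := by
    intro x
    have e := Real.hasDerivAt_exp x
    have i := hasDerivAt_id' x
    have := ((i.pow 2).div_const 2).sub
      (((i.div_const 3).const_sub 1).mul ((e.sub_const 1).sub i))
    refine this.congr_deriv ?_
    simp only [Pi.sub_apply]
    push_cast; ring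
  have hd2 : ∀ x : ℝ, HasDerivAt
      (fun x => x + 1 / 3 * (Real.exp x - 1 - x) - (1 - x / 3) * (Real.exp x - 1))
      (1 / 3 * (1 + (x - 1) * Real.exp x)) x := by
    intro x
    have e := Real.hasDerivAt_exp x
    have i := hasDerivAt_id' x
    have := (i.add (((e.sub_const 1).sub i).const_mul (1 / 3))).sub
      (((i.div_const 3).const_sub 1).mul (e.sub_const 1))
    refine this.congr_deriv ?_
    ring
  -- This is e^{-x} ≥ 1 - x multiplied by e^x. Hence the difference of the two sides is convex, with
  -- value and slope 0 at 0.
  have hn2 : ∀ x : ℝ, 0 ≤ 1 / 3 * (1 + (x - 1) * Real.exp x) := by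
    intro x
    have h1 := Real.add_one_le_exp (-x)
    have h2 : Real.exp (-x) * Real.exp x = 1 := by rw [← Real.exp_add]; simp
    have h3 := mul_le_mul_of_nonneg_right h1 (Real.exp_pos x).le
    nlinarith
  have hm2 := monotone_of_hasDerivAt_nonneg hd2 hn2
  have hn1 : ∀ x : ℝ, 0 ≤ x →
      0 ≤ x + 1 / 3 * (Real.exp x - 1 - x) - (1 - x / 3) * (Real.exp x - 1) := by
    intro x hx
    have := hm2 hx
    simpa using this
  have hm1 : MonotoneOn (fun u => u ^ 2 / 2 - (1 - u / 3) * (Real.exp u - 1 - u))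
      (Set.Ici (0 : ℝ)) := by
    refine monotoneOn_of_deriv_nonneg (convex_Ici 0)
      (fun x _ => (hd1 x).continuousAt.continuousWithinAt)
      (fun x _ => (hd1 x).differentiableAt.differentiableWithinAt) fun x hx => ?_
    rw [(hd1 x).deriv]
    rw [interior_Ici] at hx
    exact hn1 x hx.le
  have := hm1 (Set.mem_Ici.2 le_rfl) (Set.mem_Ici.2 hu) hu
  simpa using this

theorem exp_le_one_add_add_of_nonpos {u : ℝ} (hu : u ≤ 0) :
    Real.exp u ≤ 1 + u + u ^ 2 / 2 := by
  have hd1 : ∀ x : ℝ, HasDerivAt (fun u => 1 + u + u ^ 2 / 2 - Real.exp u)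
      (1 + x - Real.exp x) x := by
    intro x
    have e := Real.hasDerivAt_exp x
    have i := hasDerivAt_id' x
    have := ((i.const_add 1).add ((i.pow 2).div_const 2)).sub e
    refine this.congr_deriv ?_
    push_cast; ring
  have hm := antitone_of_hasDerivAt_nonpos hd1
    (fun x => by
      have := Real.add_one_le_exp x
      simp only [Pi.zero_apply]
      linarith)
  have := hm hu
  simp at this
  linarith

/-- For u ≤ 0 the quadratic bound holds even without the denominator; for 0 ≤ u ≤ l the factor 1 -
u/3 is at least 1 - l/3. -/
theorem exp_le_bernstein {u l : ℝ} (hul : u ≤ l) (hl0 : 0 ≤ l) (hl : l < 3) :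
    Real.exp u ≤ 1 + u + u ^ 2 / (2 * (1 - l / 3)) := by
  have hl' : 0 < 1 - l / 3 := by linarith
  rcases le_total u 0 with h | h
  · refine (exp_le_one_add_add_of_nonpos h).trans ?_
    gcongr
    linarith
  · have h1 := exp_sub_one_sub_le_of_nonneg h
    have h2 : 0 ≤ Real.exp u - 1 - u := by linarith [Real.add_one_le_exp u]
    have h3 : (1 - l / 3) * (Real.exp u - 1 - u) ≤ (1 - u / 3) * (Real.exp u - 1 - u) := by
      gcongr
    have h4 : Real.exp u - 1 - u ≤ u ^ 2 / (2 * (1 - l / 3)) := by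
      rw [le_div_iff₀ (by linarith)]
      linarith
    linarith

section Mgf

variable {E : Type*} [MeasurableSpace E] {ν : Measure E} [IsProbabilityMeasure ν] {Y : E → ℝ}

theorem integral_quadratic (hY : Integrable Y ν) (hY2 : Integrable (fun e => Y e ^ 2) ν)
    (l c : ℝ) : Integrable (fun e => 1 + l * Y e + c * Y e ^ 2) ν ∧
      ∫ e, (1 + l * Y e + c * Y e ^ 2) ∂ν = 1 + l * ∫ e, Y e ∂ν + c * ∫ e, Y e ^ 2 ∂ν := by
  have h1 : Integrable (fun e => 1 + l * Y e) ν := (integrable_const 1).add (hY.const_mul l)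
  refine ⟨h1.add (hY2.const_mul c), ?_⟩
  rw [integral_add h1 (hY2.const_mul c), integral_add (integrable_const 1) (hY.const_mul l),
    integral_const_mul, integral_const_mul]
  simp

/-- Bernstein's exponential moment bound, in the form used for Chernoff's method: `n` times the
exponent is optimized for the deviation `√(2nvx) + x/3`. -/
theorem exists_exp_moment_bernstein (hY : Measurable Y) (h0 : ∫ e, Y e ∂ν = 0)
    (hb : ∀ᵐ e ∂ν, |Y e| ≤ 1) {v : ℝ} (hv : ∫ e, Y e ^ 2 ∂ν ≤ v) {x : ℝ} (hx : 0 < x)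
    {n : ℕ} (hn : 0 < n) :
    ∃ l ψ : ℝ, 0 ≤ l ∧ ∫⁻ e, ENNReal.ofReal (Real.exp (l * Y e - ψ)) ∂ν ≤ 1 ∧
      x ≤ l * (√(2 * n * v * x) + x / 3) - n * ψ := by
  have hYi : Integrable Y ν := Integrable.of_bound hY.aestronglyMeasurable 1
    (by simpa only [Real.norm_eq_abs] using hb)
  have hY2i : Integrable (fun e => Y e ^ 2) ν := by
    refine Integrable.of_bound (hY.pow_const 2).aestronglyMeasurable 1 ?_
    filter_upwards [hb] with e he
    rw [Real.norm_eq_abs, abs_pow]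
    exact pow_le_one₀ (abs_nonneg _) he
  have hv0 : 0 ≤ v := (integral_nonneg fun e => sq_nonneg (Y e)).trans hv
  rcases hv0.eq_or_lt with rfl | hvpos
  · have hz : (fun e => Y e ^ 2) =ᵐ[ν] 0 := by
      rw [← integral_eq_zero_iff_of_nonneg (fun e => sq_nonneg (Y e)) hY2i]
      exact le_antisymm hv (integral_nonneg fun e => sq_nonneg (Y e))
    -- Here Y = 0 almost everywhere, so every l is admissible, and l = 3 turns the threshold x/3
    -- into x.
    refine ⟨3, 0, by norm_num, ?_, by simp only [mul_zero, zero_mul, Real.sqrt_zero]; linarith⟩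
    have : ∫⁻ e, ENNReal.ofReal (Real.exp (3 * Y e - 0)) ∂ν = ∫⁻ _, 1 ∂ν := by
      refine lintegral_congr_ae ?_
      filter_upwards [hz] with e he
      have : Y e = 0 := by simpa using he
      simp [this]
    rw [this]
    simp
  · set s := √(n * v) with hs
    set w := √(2 * x) with hw
    have hn' : (0 : ℝ) < n := Nat.cast_pos.2 hn
    have hspos : 0 < s := Real.sqrt_pos.2 (by positivity)
    have hwpos : 0 < w := Real.sqrt_pos.2 (by positivity)
    have hs2 : s ^ 2 = n * v := Real.sq_sqrt (by positivity)
    have hw2 : w ^ 2 = 2 * x := Real.sq_sqrt (by positivity)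
    have hsw : √(2 * n * v * x) = s * w := by
      rw [hs, hw, ← Real.sqrt_mul (by positivity)]; congr 1; ring
    -- With s² = nv and w² = 2x, this choice makes l(sw + w²/6) - l²s²/(2(1 - l/3)) equal to w²/2 =
    -- x.
    set l := w / (s + w / 3) with hl
    have hlpos : 0 < l := by positivity
    have hl3 : 1 - l / 3 = s / (s + w / 3) := by rw [hl]; field_simp; ring
    have hl3' : 0 < 1 - l / 3 := by rw [hl3]; positivity
    refine ⟨l, l ^ 2 * v / (2 * (1 - l / 3)), hlpos.le, ?_, ?_⟩
    · set c := l ^ 2 / (2 * (1 - l / 3)) with hc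
      have hc0 : 0 ≤ c := by positivity
      have hle : ∀ᵐ e ∂ν, Real.exp (l * Y e) ≤ 1 + l * Y e + c * Y e ^ 2 := by
        filter_upwards [hb] with e he
        have h1 : l * Y e ≤ l := by nlinarith [(abs_le.1 he).2]
        refine (exp_le_bernstein h1 hlpos.le (by linarith)).trans (le_of_eq ?_)
        rw [hc]; ring
      obtain ⟨hint, hInt⟩ := integral_quadratic hYi hY2i l c
      have hI : ∫ e, (1 + l * Y e + c * Y e ^ 2) ∂ν ≤ Real.exp (c * v) := by
        rw [hInt, h0]
        have h1 := Real.add_one_le_exp (c * v)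
        have h2 := mul_le_mul_of_nonneg_left hv hc0
        linarith
      have hψ : l ^ 2 * v / (2 * (1 - l / 3)) = c * v := by rw [hc]; ring
      rw [hψ]
      calc ∫⁻ e, ENNReal.ofReal (Real.exp (l * Y e - c * v)) ∂ν
          ≤ ∫⁻ e, ENNReal.ofReal (Real.exp (-(c * v)))
              * ENNReal.ofReal (1 + l * Y e + c * Y e ^ 2) ∂ν := by
            refine lintegral_mono_ae ?_
            filter_upwards [hle] with e he
            rw [← ENNReal.ofReal_mul (Real.exp_pos _).le, sub_eq_neg_add, Real.exp_add]
            exact ENNReal.ofReal_le_ofReal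
              (mul_le_mul_of_nonneg_left he (Real.exp_pos _).le)
        _ = ENNReal.ofReal (Real.exp (-(c * v)))
              * ENNReal.ofReal (∫ e, (1 + l * Y e + c * Y e ^ 2) ∂ν) := by
            rw [lintegral_const_mul' _ _ ENNReal.ofReal_ne_top,
              ofReal_integral_eq_lintegral_ofReal hint]
            filter_upwards [hle] with e he
            exact (Real.exp_pos _).le.trans he
        _ ≤ 1 := by
            rw [← ENNReal.ofReal_mul (Real.exp_pos _).le, ← ENNReal.ofReal_one]
            refine ENNReal.ofReal_le_ofReal ?_
            calc _ ≤ Real.exp (-(c * v)) * Real.exp (c * v) :=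
                  mul_le_mul_of_nonneg_left hI (Real.exp_pos _).le
              _ = 1 := by rw [← Real.exp_add]; simp
    · rw [hsw, hl3]
      have hx' : x = w ^ 2 / 2 := by linarith
      have hnv : n * (l ^ 2 * v / (2 * (s / (s + w / 3)))) = l ^ 2 * s ^ 2
          / (2 * (s / (s + w / 3))) := by rw [hs2]; ring
      rw [hnv, hx', hl]
      apply le_of_eq
      field_simp
      ring

/-- The lower tail of a nonnegative variable with small second moment is sub-Gaussian. -/
theorem exists_exp_moment_of_nonneg (hY : Measurable Y) (hY0 : ∀ e, 0 ≤ Y e)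
    (hb : ∀ᵐ e ∂ν, Y e ≤ 1) {v : ℝ} (hv : ∫ e, Y e ^ 2 ∂ν ≤ v) (hvpos : 0 < v) {x : ℝ}
    (hx : 0 < x) {n : ℕ} (hn : 0 < n) :
    ∃ l ψ : ℝ, 0 ≤ l ∧ ∫⁻ e, ENNReal.ofReal (Real.exp (l * (∫ e, Y e ∂ν - Y e) - ψ)) ∂ν ≤ 1 ∧
      x ≤ l * √(2 * n * v * x) - n * ψ := by
  have hYi : Integrable Y ν := by
    refine Integrable.of_bound hY.aestronglyMeasurable 1 ?_
    filter_upwards [hb] with e he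
    rwa [Real.norm_eq_abs, abs_of_nonneg (hY0 e)]
  have hY2i : Integrable (fun e => Y e ^ 2) ν := by
    refine Integrable.of_bound (hY.pow_const 2).aestronglyMeasurable 1 ?_
    filter_upwards [hb] with e he
    rw [Real.norm_eq_abs, abs_pow, abs_of_nonneg (hY0 e)]
    exact pow_le_one₀ (hY0 e) he
  set m := ∫ e, Y e ∂ν with hm
  have hn' : (0 : ℝ) < n := Nat.cast_pos.2 hn
  set s := √(n * v) with hs
  set w := √(2 * x) with hw
  have hspos : 0 < s := Real.sqrt_pos.2 (by positivity)
  have hwpos : 0 < w := Real.sqrt_pos.2 (by positivity)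
  have hs2 : s ^ 2 = n * v := Real.sq_sqrt (by positivity)
  have hw2 : w ^ 2 = 2 * x := Real.sq_sqrt (by positivity)
  have hsw : √(2 * n * v * x) = s * w := by
    rw [hs, hw, ← Real.sqrt_mul (by positivity)]; congr 1; ring
  -- This maximizes l·sw - l²s²/2, with value w²/2 = x.
  set l := w / s with hl
  have hlpos : 0 < l := by positivity
  refine ⟨l, l ^ 2 * v / 2, hlpos.le, ?_, ?_⟩
  · have hle : ∀ e, Real.exp (-(l * Y e)) ≤ 1 + (-l) * Y e + l ^ 2 / 2 * Y e ^ 2 := by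
      intro e
      refine (exp_le_one_add_add_of_nonpos (u := -(l * Y e)) ?_).trans (le_of_eq (by ring))
      have := mul_nonneg hlpos.le (hY0 e)
      linarith
    obtain ⟨hint, hInt⟩ := integral_quadratic hYi hY2i (-l) (l ^ 2 / 2)
    have hI : ∫ e, (1 + (-l) * Y e + l ^ 2 / 2 * Y e ^ 2) ∂ν
        ≤ Real.exp (-(l * m) + l ^ 2 * v / 2) := by
      rw [hInt, ← hm]
      have h1 := Real.add_one_le_exp (-(l * m) + l ^ 2 * v / 2)
      have h2 := mul_le_mul_of_nonneg_left hv (by positivity : 0 ≤ l ^ 2 / 2)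
      linarith
    calc ∫⁻ e, ENNReal.ofReal (Real.exp (l * (m - Y e) - l ^ 2 * v / 2)) ∂ν
        ≤ ∫⁻ e, ENNReal.ofReal (Real.exp (l * m - l ^ 2 * v / 2))
            * ENNReal.ofReal (1 + (-l) * Y e + l ^ 2 / 2 * Y e ^ 2) ∂ν := by
          refine lintegral_mono fun e => ?_
          rw [← ENNReal.ofReal_mul (Real.exp_pos _).le]
          refine ENNReal.ofReal_le_ofReal ?_
          have : l * (m - Y e) - l ^ 2 * v / 2 = (l * m - l ^ 2 * v / 2) + -(l * Y e) := by ring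
          rw [this, Real.exp_add]
          exact mul_le_mul_of_nonneg_left (hle e) (Real.exp_pos _).le
      _ = ENNReal.ofReal (Real.exp (l * m - l ^ 2 * v / 2))
            * ENNReal.ofReal (∫ e, (1 + (-l) * Y e + l ^ 2 / 2 * Y e ^ 2) ∂ν) := by
          rw [lintegral_const_mul' _ _ ENNReal.ofReal_ne_top,
            ofReal_integral_eq_lintegral_ofReal hint]
          exact Filter.Eventually.of_forall fun e => (Real.exp_pos _).le.trans (hle e)
      _ ≤ 1 := by
          rw [← ENNReal.ofReal_mul (Real.exp_pos _).le, ← ENNReal.ofReal_one]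
          refine ENNReal.ofReal_le_ofReal ?_
          calc _ ≤ Real.exp (l * m - l ^ 2 * v / 2) * Real.exp (-(l * m) + l ^ 2 * v / 2) :=
                mul_le_mul_of_nonneg_left hI (Real.exp_pos _).le
            _ = 1 := by rw [← Real.exp_add]; simp
  · have hnv : n * (l ^ 2 * v / 2) = l ^ 2 * s ^ 2 / 2 := by rw [hs2]; ring
    have hx' : x = w ^ 2 / 2 := by linarith
    rw [hsw, hnv, hx', hl]
    apply le_of_eq
    field_simp
    ring

end Mgf

/-! ### Charging the gap of a round to its arms -/

/-- The cost, in units of the gap, charged to an arm at its `n`-th play. -/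
noncomputable def armCharge (K a : ℝ) (n : ℕ) : ℝ :=
  if (n : ℝ) ≤ K * a then min √(a / n) (a / n) else 0

theorem armCharge_nonneg {K a : ℝ} (ha : 0 ≤ a) (n : ℕ) : 0 ≤ armCharge K a n := by
  unfold armCharge
  split_ifs
  · exact le_min (Real.sqrt_nonneg _) (by positivity)
  · exact le_rfl

theorem armCharge_zero (K a : ℝ) : armCharge K a 0 = 0 := by
  simp [armCharge]

/-- A primitive of `min √(a/x) (a/x)`, up to a jump at `a`. -/
noncomputable def armPotential (a x : ℝ) : ℝ :=
  if x ≤ a then 2 * √(a * x) else 3 * a + a * Real.log (x / a)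

theorem armPotential_mono {a : ℝ} (ha : 0 < a) : Monotone (armPotential a) := by
  intro x y hxy
  unfold armPotential
  split_ifs with h1 h2 h2
  · gcongr
  · have h3 : √(a * x) ≤ a := by
      rw [Real.sqrt_le_left ha.le]; nlinarith
    have h4 : 0 ≤ Real.log (y / a) := Real.log_nonneg (by rw [le_div_iff₀ ha]; linarith)
    have := mul_nonneg ha.le h4
    linarith
  · exact absurd (hxy.trans h2) h1
  · have : 0 < x := ha.trans (not_le.1 h1)
    gcongr

/-- Below a this is concavity of the square root, above a it is log(n+1) - log n ≥ 1/(n+1). The step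
that crosses a is paid by the jump of the potential from at most 2a to at least 3a. -/
theorem min_sqrt_le_armPotential_sub {a : ℝ} (ha : 0 < a) (n : ℕ) :
    min √(a / (n + 1 : ℕ)) (a / (n + 1 : ℕ))
      ≤ armPotential a (n + 1 : ℕ) - armPotential a n := by
  have hn : (0 : ℝ) ≤ n := Nat.cast_nonneg n
  push_cast
  unfold armPotential
  split_ifs with h1 h2 h2
  · refine (min_le_left _ _).trans ?_
    rw [Real.sqrt_div ha.le, Real.sqrt_mul ha.le, Real.sqrt_mul ha.le]
    set s := √((n : ℝ) + 1)
    set r := √(n : ℝ)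
    have hs : s ^ 2 = n + 1 := Real.sq_sqrt (by linarith)
    have hr : r ^ 2 = n := Real.sq_sqrt hn
    have hspos : 0 < s := Real.sqrt_pos.2 (by linarith)
    have hr0 : 0 ≤ r := Real.sqrt_nonneg _
    have h3 : 1 ≤ 2 * (s - r) * s := by nlinarith [sq_nonneg (s - r)]
    rw [div_le_iff₀ hspos]
    have := mul_le_mul_of_nonneg_left h3 (Real.sqrt_nonneg a)
    linarith
  · linarith
  · refine (min_le_right _ _).trans ?_
    have h3 : √(a * n) ≤ a := by
      rw [Real.sqrt_le_left ha.le]; nlinarith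
    have h4 : 0 ≤ Real.log ((n + 1) / a) := Real.log_nonneg (by rw [le_div_iff₀ ha]; linarith)
    have h5 := mul_nonneg ha.le h4
    have h6 : a / (n + 1) ≤ a := div_le_self ha.le (by linarith)
    linarith
  · refine (min_le_right _ _).trans ?_
    have hnpos : (0 : ℝ) < n := ha.trans (not_le.1 h2)
    rw [Real.log_div (by positivity) ha.ne', Real.log_div hnpos.ne' ha.ne']
    have h3 := Real.log_le_sub_one_of_pos (show 0 < (n : ℝ) / (n + 1) by positivity)
    rw [Real.log_div hnpos.ne' (by positivity)] at h3
    have h4 : (n : ℝ) / (n + 1) - 1 = -(1 / (n + 1)) := by field_simp; ring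
    rw [h4] at h3
    have h5 : 1 / ((n : ℝ) + 1) ≤ Real.log (n + 1) - Real.log n := by linarith
    have h6 := mul_le_mul_of_nonneg_left h5 ha.le
    have h7 : a / ((n : ℝ) + 1) = a * (1 / (n + 1)) := by ring
    rw [h7]
    linarith

/-- The charges telescope against the potential. The cutoff freezes it at K a, where its value is at
most 3a + a log K; without a cutoff the bound would grow with N. -/
theorem sum_armCharge_le {K a : ℝ} (hK : 1 ≤ K) (ha : 0 ≤ a) (N : ℕ) :
    ∑ n ∈ Finset.range N, armCharge K a (n + 1) ≤ a * (3 + Real.log K) := by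
  rcases ha.eq_or_lt with rfl | ha
  · simp [armCharge]
  have hlog : 0 ≤ Real.log K := Real.log_nonneg hK
  have key : ∀ N : ℕ, ∑ n ∈ Finset.range N, armCharge K a (n + 1)
      ≤ armPotential a (min N (K * a)) := by
    intro N
    induction N with
    | zero =>
      have : min ((0 : ℕ) : ℝ) (K * a) = 0 := by
        rw [Nat.cast_zero]; exact min_eq_left (by positivity)
      rw [this]
      simp [armPotential, ha.le]
    | succ N ih =>
      rw [Finset.sum_range_succ]
      by_cases h : ((N + 1 : ℕ) : ℝ) ≤ K * a
      · have h1 := min_sqrt_le_armPotential_sub ha N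
        have h2 : (N : ℝ) ≤ K * a := le_trans (by push_cast; linarith) h
        rw [min_eq_left h]
        rw [min_eq_left h2] at ih
        rw [armCharge, if_pos h]
        linarith
      · rw [armCharge, if_neg h, add_zero]
        refine ih.trans (armPotential_mono ha ?_)
        exact min_le_min_right _ (by push_cast; linarith)
  refine (key N).trans ((armPotential_mono ha (min_le_right _ _)).trans ?_)
  unfold armPotential
  split_ifs with h
  · have h3 : √(a * (K * a)) ≤ a := by
      rw [Real.sqrt_le_left ha.le]; nlinarith
    have := mul_nonneg ha.le hlog
    linarith
  · rw [mul_div_assoc, div_self ha.ne', mul_one]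
    linarith

/-- The gap of a round is covered by the charges of the arms of its batch. -/
theorem gap_le_sum_armCharge {ι : Type*} (s : Finset ι) {Δ g K : ℝ} (hΔ : 0 < Δ) (hg : 0 ≤ g)
    (hK : 1 ≤ K) (hs : (s.card : ℝ) ≤ K) (N : ι → ℕ) (hN : ∀ j ∈ s, N j ≠ 0) (δ : ι → ℝ)
    (hδ : ∀ j ∈ s, 0 < δ j) (hδΔ : ∀ j ∈ s, δ j ≤ Δ)
    (h : Δ ^ 2 ≤ g * ∑ j ∈ s, 1 / (N j : ℝ)) :
    Δ ≤ ∑ j ∈ s, δ j * armCharge K (2 * g / δ j ^ 2) (N j) := by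
  have hnn : ∀ j ∈ s, 0 ≤ δ j * armCharge K (2 * g / δ j ^ 2) (N j) := fun j hj =>
    mul_nonneg (hδ j hj).le (armCharge_nonneg (by positivity) _)
  have hNpos : ∀ j ∈ s, (0 : ℝ) < N j := fun j hj => Nat.cast_pos.2 (Nat.pos_of_ne_zero (hN j hj))
  -- If 2g/N_j ≥ Δ² for one arm, that arm pays alone: with a = 2g/δ_j² one has a/N_j ≥ (Δ/δ_j)² ≥ 1,
  -- so both entries of the minimum are at least Δ/δ_j.
  by_cases hex : ∃ j ∈ s, 2 * g / (N j : ℝ) ≥ Δ ^ 2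
  · obtain ⟨j, hj, hjN⟩ := hex
    refine le_trans ?_ (Finset.single_le_sum hnn hj)
    have hd := hδ j hj
    have hn := hNpos j hj
    have h1 : 1 ≤ Δ / δ j := by rw [le_div_iff₀ hd]; linarith [hδΔ j hj]
    have h2 : (Δ / δ j) ^ 2 ≤ 2 * g / δ j ^ 2 / N j := by
      rw [div_pow, div_right_comm]
      gcongr
    have h3 : (N j : ℝ) ≤ K * (2 * g / δ j ^ 2) := by
      have h4 : 1 ≤ 2 * g / δ j ^ 2 / N j := by nlinarith
      rw [le_div_iff₀ hn] at h4
      have h5 : 0 ≤ 2 * g / δ j ^ 2 := by positivity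
      nlinarith
    rw [armCharge, if_pos h3]
    have h4 : Δ / δ j ≤ min √(2 * g / δ j ^ 2 / N j) (2 * g / δ j ^ 2 / N j) :=
      le_min (Real.le_sqrt_of_sq_le h2) (by nlinarith)
    calc Δ = δ j * (Δ / δ j) := by field_simp
      _ ≤ _ := mul_le_mul_of_nonneg_left h4 hd.le
  · push Not at hex
    -- Otherwise every arm pays 2g/(ΔN_j) up to an error Δ/K, and once N_j Δ² > 2gK that amount is
    -- itself below the error. Summation gives 2Δ - Δ: the factor 2 in a compensates the errors of
    -- at most K arms.
    have hterm : ∀ j ∈ s, 2 * g / Δ * (1 / N j) - Δ / K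
        ≤ δ j * armCharge K (2 * g / δ j ^ 2) (N j) := by
      intro j hj
      have hd := hδ j hj
      have hn := hNpos j hj
      have hdΔ := hδΔ j hj
      by_cases hc : (N j : ℝ) * Δ ^ 2 ≤ 2 * g * K
      · have h0 : 2 * g / Δ * (1 / N j) ≤ δ j * armCharge K (2 * g / δ j ^ 2) (N j) := by
          have h3 : (N j : ℝ) ≤ K * (2 * g / δ j ^ 2) := by
            have : (N j : ℝ) * δ j ^ 2 ≤ 2 * g * K :=
              le_trans (by gcongr) hc
            rw [← mul_div_assoc, le_div_iff₀ (by positivity)]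
            linarith
          rw [armCharge, if_pos h3, mul_min_of_nonneg _ _ hd.le]
          refine le_min ?_ ?_
          · have h4 : δ j * √(2 * g / δ j ^ 2 / N j) = √(2 * g / N j) := by
              have : 2 * g / N j = δ j ^ 2 * (2 * g / δ j ^ 2 / N j) := by field_simp
              rw [this, Real.sqrt_mul (by positivity), Real.sqrt_sq hd.le]
            rw [h4]
            refine Real.le_sqrt_of_sq_le ?_
            have h5 : (2 * g / Δ * (1 / N j)) ^ 2 = (2 * g / N j) * ((2 * g / N j) / Δ ^ 2) := by
              ring
            rw [h5]
            refine mul_le_of_le_one_right (by positivity) ?_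
            rw [div_le_one (by positivity)]
            exact (hex j hj).le
          · have h5 : δ j * (2 * g / δ j ^ 2 / N j) = 2 * g / δ j * (1 / N j) := by
              field_simp
            rw [h5]
            gcongr
        have : 0 ≤ Δ / K := by positivity
        linarith
      · refine le_trans ?_ (hnn j hj)
        push Not at hc
        rw [sub_nonpos, le_div_iff₀ (by linarith)]
        have : 2 * g / Δ * (1 / N j) * K = 2 * g * K / (N j * Δ) := by field_simp
        rw [this, div_le_iff₀ (by positivity)]
        nlinarith
    refine le_trans ?_ (Finset.sum_le_sum hterm)
    rw [Finset.sum_sub_distrib, ← Finset.mul_sum, Finset.sum_const, nsmul_eq_mul]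
    have h1 : Δ * 2 ≤ 2 * g / Δ * ∑ j ∈ s, 1 / (N j : ℝ) := by
      have : 2 * g / Δ * ∑ j ∈ s, 1 / (N j : ℝ) = 2 * (g * ∑ j ∈ s, 1 / (N j : ℝ)) / Δ := by ring
      rw [this, le_div_iff₀ hΔ]
      nlinarith
    have h2 : (s.card : ℝ) * (Δ / K) ≤ Δ := by
      rw [← mul_div_assoc, div_le_iff₀ (by linarith)]
      nlinarith
    linarith

/-! ### Gaps, play counts and pathwise sums -/

namespace SemiBandit

variable {L M : ℕ} (P : SemiBandit L M)

theorem finite_gap_image (α : ℝ) (s : Set P.actions) : (P.gap α '' s).Finite :=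
  (Set.toFinite s).image _

theorem gapMin_le {α : ℝ} {j : Fin L} {A : P.actions} (hA : A ∈ P.badBatches α j) :
    P.gapMin α j ≤ P.gap α A :=
  csInf_le (P.finite_gap_image α _).bddBelow (Set.mem_image_of_mem _ hA)

theorem gap_le_gapMax {α : ℝ} {j : Fin L} {A : P.actions} (hA : A ∈ P.badBatches α j) :
    P.gap α A ≤ P.gapMax α j :=
  le_csSup (P.finite_gap_image α _).bddAbove (Set.mem_image_of_mem _ hA)

theorem mem_badArms {α : ℝ} {j : Fin L} : j ∈ P.badArms α ↔ (P.badBatches α j).Nonempty := by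
  simp [badArms]

theorem gapMin_pos {α : ℝ} {j : Fin L} (hj : j ∈ P.badArms α) : 0 < P.gapMin α j := by
  have hne : (P.gap α '' P.badBatches α j).Nonempty := (P.mem_badArms.1 hj).image _
  obtain ⟨A, hA, h⟩ := hne.csInf_mem (P.finite_gap_image α _)
  rw [gapMin, ← h]
  exact hA.2

theorem gapMin_le_gapMax {α : ℝ} {j : Fin L} (hj : j ∈ P.badArms α) :
    P.gapMin α j ≤ P.gapMax α j := by
  obtain ⟨A, hA⟩ := P.mem_badArms.1 hj
  exact (P.gapMin_le hA).trans (P.gap_le_gapMax hA)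

theorem maxGap_nonneg (α : ℝ) : 0 ≤ P.maxGap α := by
  refine Real.sSup_nonneg ?_
  rintro _ ⟨A, hA, rfl⟩
  exact le_of_lt hA

theorem gap_le_maxGap (α : ℝ) (A : P.actions) : P.gap α A ≤ P.maxGap α := by
  rcases le_or_gt (P.gap α A) 0 with h | h
  · exact h.trans (P.maxGap_nonneg α)
  · exact le_csSup (P.finite_gap_image α _).bddAbove (Set.mem_image_of_mem _ h)

variable {P} in
theorem count_succ (a : ℕ → P.actions) (j : Fin L) (t : ℕ) :
    count a j (t + 1) = count a j t + if j ∈ (a (t + 1)).1 then 1 else 0 := by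
  unfold count
  rw [← Finset.insert_Icc_right_eq_Icc_add_one (by omega), Finset.filter_insert]
  split_ifs with h
  · rw [Finset.card_insert_of_notMem (by simp)]
  · rfl

variable {P} in
theorem count_zero (a : ℕ → P.actions) (j : Fin L) : count a j 0 = 0 := by
  simp [count]

variable {P} in
-- The count just before a play runs once through 0, …, N_j(T) - 1, so a sum over rounds becomes a
-- sum over the plays of one arm.
theorem sum_count (a : ℕ → P.actions) (j : Fin L) (φ : ℕ → ℝ) (T : ℕ) :
    ∑ t ∈ Finset.Icc 1 T, (if j ∈ (a t).1 then φ (count a j (t - 1)) else 0)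
      = ∑ n ∈ Finset.range (count a j T), φ n := by
  induction T with
  | zero => simp [count_zero]
  | succ T ih =>
    rw [Finset.sum_Icc_succ_top (by omega), ih, count_succ]
    split_ifs with h
    · rw [Finset.sum_range_succ, Nat.add_sub_cancel]
    · simp

/-- The total gap of the rounds whose gap is controlled by the confidence widths. -/
theorem sum_gap_le {α g : ℝ} {K : ℕ} (hg : 0 ≤ g) (hK : 1 ≤ K)
    (hcard : ∀ A ∈ P.actions, A.card ≤ K) (a : ℕ → P.actions) (T : ℕ) (B : Finset ℕ)
    (hB : B ⊆ Finset.Icc 1 T) (hpos : ∀ t ∈ B, 0 < P.gap α (a t))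
    (hN : ∀ t ∈ B, ∀ j, count a j (t - 1) ≠ 0)
    (h : ∀ t ∈ B, P.gap α (a t) ^ 2 ≤ g * ∑ j ∈ (a t).1, 1 / (count a j (t - 1) : ℝ)) :
    ∑ t ∈ B, P.gap α (a t)
      ≤ ∑ j ∈ P.badArms α, 2 * g / P.gapMin α j * (3 + Real.log K) := by
  have hK' : (1 : ℝ) ≤ K := by exact_mod_cast hK
  set φ : Fin L → ℕ → ℝ := fun j n =>
    P.gapMin α j * armCharge K (2 * g / P.gapMin α j ^ 2) n with hφ
  have hmem : ∀ t ∈ B, ∀ j ∈ (a t).1, a t ∈ P.badBatches α j := fun t ht j hj => ⟨hj, hpos t ht⟩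
  have hsub : ∀ t ∈ B, (a t).1 ⊆ P.badArms α := fun t ht j hj =>
    P.mem_badArms.2 ⟨_, hmem t ht j hj⟩
  have hφ0 : ∀ j ∈ P.badArms α, ∀ n, 0 ≤ φ j n := fun j hj n =>
    mul_nonneg (P.gapMin_pos hj).le (armCharge_nonneg (by positivity) _)
  calc ∑ t ∈ B, P.gap α (a t)
      ≤ ∑ t ∈ B, ∑ j ∈ (a t).1, φ j (count a j (t - 1)) := by
        refine Finset.sum_le_sum fun t ht => ?_
        exact gap_le_sum_armCharge _ (hpos t ht) hg hK' (by exact_mod_cast hcard _ (a t).2)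
          (fun j => count a j (t - 1)) (fun j _ => hN t ht j) (P.gapMin α)
          (fun j hj => P.gapMin_pos (hsub t ht hj)) (fun j hj => P.gapMin_le (hmem t ht j hj))
          (h t ht)
    _ = ∑ t ∈ B, ∑ j ∈ P.badArms α, (if j ∈ (a t).1 then φ j (count a j (t - 1)) else 0) := by
        refine Finset.sum_congr rfl fun t ht => ?_
        rw [← Finset.sum_filter]
        congr 1
        ext j
        simp only [Finset.mem_filter]
        exact ⟨fun hj => ⟨hsub t ht hj, hj⟩, fun hj => hj.2⟩
    _ ≤ ∑ t ∈ Finset.Icc 1 T, ∑ j ∈ P.badArms α,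
          (if j ∈ (a t).1 then φ j (count a j (t - 1)) else 0) := by
        refine Finset.sum_le_sum_of_subset_of_nonneg hB fun t _ _ =>
          Finset.sum_nonneg fun j hj => ?_
        split_ifs
        · exact hφ0 j hj _
        · exact le_rfl
    _ = ∑ j ∈ P.badArms α, ∑ n ∈ Finset.range (count a j T), φ j n := by
        rw [Finset.sum_comm]
        exact Finset.sum_congr rfl fun j _ => sum_count a j (φ j) T
    _ ≤ _ := by
        refine Finset.sum_le_sum fun j hj => ?_
        have hd := P.gapMin_pos hj
        -- One more term is added and the term n = 0, which vanishes, is split off, so that the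
        -- index starts at 1 as in `sum_armCharge_le`.
        have h1 : ∑ n ∈ Finset.range (count a j T), φ j n
            ≤ ∑ n ∈ Finset.range (count a j T + 1), φ j n :=
          Finset.sum_le_sum_of_subset_of_nonneg (Finset.range_mono (Nat.le_succ _))
            fun n _ _ => hφ0 j hj n
        refine h1.trans ?_
        rw [Finset.sum_range_succ']
        simp only [hφ, armCharge_zero, mul_zero, add_zero, ← Finset.mul_sum]
        have h2 := sum_armCharge_le hK' (by positivity : 0 ≤ 2 * g / P.gapMin α j ^ 2)
          (count a j T)
        refine (mul_le_mul_of_nonneg_left h2 hd.le).trans (le_of_eq ?_)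
        field_simp

/-- At most `L` rounds are initial: each of them plays a new arm. -/
theorem card_initial_le (a : ℕ → P.actions) (T : ℕ)
    (h : ∀ t ∈ Finset.Icc 1 T, (∃ j, count a j (t - 1) = 0) →
      ∃ j, count a j (t - 1) = 0 ∧ j ∈ (a t).1) :
    ((Finset.Icc 1 T).filter fun t => ∃ j, count a j (t - 1) = 0).card ≤ L := by
  rcases isEmpty_or_nonempty (Fin L) with hL | hL
  · simp
  choose! f hf using h
  have hmono : ∀ j, Monotone (count a j) := fun j => monotone_nat_of_le_succ fun n => by
    rw [count_succ]; omega
  have hinj : Set.InjOn f ((Finset.Icc 1 T).filter fun t => ∃ j, count a j (t - 1) = 0) := by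
    -- The arm chosen in round s has positive count from then on, so it cannot be an unplayed arm of
    -- a later round.
    have aux : ∀ s ∈ ((Finset.Icc 1 T).filter fun t => ∃ j, count a j (t - 1) = 0),
        ∀ t ∈ ((Finset.Icc 1 T).filter fun t => ∃ j, count a j (t - 1) = 0),
        s < t → f s ≠ f t := by
      intro s hs t ht hst heq
      rw [Finset.mem_filter] at hs ht
      have h1 := hf s hs.1 hs.2
      have h2 := hf t ht.1 ht.2
      obtain ⟨s, rfl⟩ : ∃ s', s = s' + 1 := ⟨s - 1, by have := (Finset.mem_Icc.1 hs.1).1; omega⟩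
      have h3 := count_succ a (f (s + 1)) s
      rw [if_pos h1.2] at h3
      have h4 := hmono (f (s + 1)) (show s + 1 ≤ t - 1 by omega)
      rw [← heq] at h2
      omega
    intro s hs t ht heq
    rcases lt_trichotomy s t with hlt | hlt | hlt
    · exact absurd heq (aux s hs t ht hlt)
    · exact hlt
    · exact absurd heq.symm (aux t ht s hs hlt)
  have := Finset.card_le_card_of_injOn (t := Finset.univ) f (fun _ _ => Finset.mem_univ _) hinj
  simpa using this

end SemiBandit

/-! ### Deviation bounds under adaptive sampling -/

section UnitInterval

variable {E : Type*} [MeasurableSpace E] {ν : Measure E} [IsProbabilityMeasure ν] {ξ : E → ℝ}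

theorem integrable_of_mem_Icc {a b : ℝ} (hξ : Measurable ξ) (h : ∀ᵐ e ∂ν, ξ e ∈ Set.Icc a b) :
    Integrable ξ ν :=
  Integrable.of_mem_Icc a b hξ.aemeasurable h

theorem integral_mem_Icc {a b : ℝ} (hξ : Measurable ξ) (h : ∀ᵐ e ∂ν, ξ e ∈ Set.Icc a b) :
    ∫ e, ξ e ∂ν ∈ Set.Icc a b := by
  have hi := integrable_of_mem_Icc hξ h
  constructor
  · have := integral_mono_ae (integrable_const a) hi (h.mono fun e he => he.1)
    simpa using this
  · have := integral_mono_ae hi (integrable_const b) (h.mono fun e he => he.2)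
    simpa using this

/-- The variance of a variable with values in `[0,1]` and mean `p` is at most `p (1 - p)`. -/
theorem integral_sub_sq_le (hξ : Measurable ξ) (h : ∀ᵐ e ∂ν, ξ e ∈ Set.Icc (0 : ℝ) 1) :
    ∫ e, (ξ e - ∫ e, ξ e ∂ν) ^ 2 ∂ν ≤ (∫ e, ξ e ∂ν) * (1 - ∫ e, ξ e ∂ν) := by
  set p := ∫ e, ξ e ∂ν with hp
  have hi := integrable_of_mem_Icc hξ h
  have h1 : Integrable (fun e => (1 - 2 * p) * ξ e) ν := hi.const_mul _
  calc ∫ e, (ξ e - p) ^ 2 ∂ν ≤ ∫ e, ((1 - 2 * p) * ξ e + p ^ 2) ∂ν := by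
        refine integral_mono_ae ?_ (h1.add (integrable_const _)) ?_
        · refine integrable_of_mem_Icc (a := 0) (b := 1) (by fun_prop) ?_
          have hpm := integral_mem_Icc hξ h
          rw [← hp] at hpm
          filter_upwards [h] with e he
          refine ⟨sq_nonneg _, ?_⟩
          rw [sq_le_one_iff_abs_le_one, abs_le]
          constructor <;> linarith [he.1, he.2, hpm.1, hpm.2]
        · filter_upwards [h] with e he
          nlinarith [mul_nonneg he.1 (sub_nonneg.2 he.2)]
    _ = p * (1 - p) := by
        rw [integral_add h1 (integrable_const _), integral_const_mul, ← hp]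
        simp
        ring

end UnitInterval

/-- Multiplying by an independent factor of mean at most `1` on an event does not increase the
expectation. -/
theorem lintegral_indicator_mul_add_le {Ω : Type*} {m₁ m₂ mΩ : MeasurableSpace Ω} {μ : Measure Ω}
    (h₁ : m₁ ≤ mΩ) (h₂ : m₂ ≤ mΩ) (hind : Indep m₁ m₂ μ) {S : Set Ω} (hS : MeasurableSet[m₁] S)
    {Z g : Ω → ENNReal} (hZ : Measurable[m₁] Z) (hg : Measurable[m₂] g)
    (hle : ∫⁻ ω, g ω ∂μ ≤ 1) :
    ∫⁻ ω, (S.indicator Z ω * g ω + Sᶜ.indicator Z ω) ∂μ ≤ ∫⁻ ω, Z ω ∂μ := by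
  have hSm : MeasurableSet S := h₁ _ hS
  have hZm : Measurable Z := hZ.mono h₁ le_rfl
  have hmul := lintegral_mul_eq_lintegral_mul_lintegral_of_independent_measurableSpace
    h₁ h₂ hind (hZ.indicator hS) hg
  rw [lintegral_add_right _ (hZm.indicator hSm.compl), hmul]
  calc _ ≤ ∫⁻ ω, S.indicator Z ω ∂μ + ∫⁻ ω, Sᶜ.indicator Z ω ∂μ := by
        gcongr
        exact mul_le_of_le_one_right' hle
    _ = ∫⁻ ω, Z ω ∂μ := by
        rw [lintegral_indicator hSm, lintegral_indicator hSm.compl]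
        exact lintegral_add_compl Z hSm

namespace SemiBandit

variable {L M : ℕ} {P : SemiBandit L M} {Ω : Type*}
  {A : ℕ → Ω → P.actions} {X : ℕ → Ω → Fin M → Fin L → ℝ}

theorem comap_feedback_le_past {s t : ℕ} (hs : s ∈ Finset.Ico 1 t) :
    MeasurableSpace.comap (X s) inferInstance ≤ past A X t :=
  le_sup_left.trans (le_iSup₂_of_le (f := fun s (_ : s ∈ Finset.Ico 1 t) =>
    MeasurableSpace.comap (X s) inferInstance ⊔ MeasurableSpace.comap (A s) ⊤) s hs le_rfl)

theorem comap_batch_le_past {s t : ℕ} (hs : s ∈ Finset.Ico 1 t) :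
    MeasurableSpace.comap (A s) ⊤ ≤ past A X t :=
  le_sup_right.trans (le_iSup₂_of_le (f := fun s (_ : s ∈ Finset.Ico 1 t) =>
    MeasurableSpace.comap (X s) inferInstance ⊔ MeasurableSpace.comap (A s) ⊤) s hs le_rfl)

theorem measurable_feedback_past {s t : ℕ} (hs : s ∈ Finset.Ico 1 t) :
    Measurable[past A X t] (X s) :=
  measurable_iff_comap_le.2 (comap_feedback_le_past hs)

theorem measurableSet_mem_batch_past {s t : ℕ} (hs : s ∈ Finset.Ico 1 t) (j : Fin L) :
    MeasurableSet[past A X t] {ω | j ∈ (A s ω).1} :=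
  comap_batch_le_past hs _ ⟨{B | j ∈ B.1}, trivial, rfl⟩

variable [mΩ : MeasurableSpace Ω] {μ : Measure Ω}
  {oracle : (Fin M → Fin L → ℝ) → PMF P.actions} {T : ℕ}

theorem IsBCUCB.comap_batch_le (h : P.IsBCUCB μ oracle T A X) {t : ℕ}
    (ht : t ∈ Finset.Icc 1 T) : MeasurableSpace.comap (A t) ⊤ ≤ mΩ := by
  rintro _ ⟨s, -, rfl⟩
  rw [← Set.biUnion_preimage_singleton]
  exact MeasurableSet.biUnion (Set.to_countable s) fun B _ => h.measurable_batch t ht B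

theorem IsBCUCB.past_le (h : P.IsBCUCB μ oracle T A X) {t : ℕ} (ht : t ≤ T + 1) :
    past A X t ≤ mΩ := by
  refine iSup₂_le fun s hs => ?_
  have hs' : s ∈ Finset.Icc 1 T := by
    rw [Finset.mem_Ico] at hs
    rw [Finset.mem_Icc]
    omega
  exact sup_le (h.measurable_feedback s hs').comap_le (h.comap_batch_le hs')

/-- The exponential supermartingale of the observations of the arm `j`. -/
theorem IsBCUCB.lintegral_prod_le [IsProbabilityMeasure μ] (h : P.IsBCUCB μ oracle T A X)
    (j : Fin L) {e : (Fin M → Fin L → ℝ) → ENNReal} (he : Measurable e)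
    (hle : ∫⁻ x, e x ∂P.law ≤ 1) {n : ℕ} (hn : n ≤ T) :
    ∫⁻ ω, ∏ τ ∈ Finset.Icc 1 n, (if j ∈ (A τ ω).1 then e (X τ ω) else 1) ∂μ ≤ 1 := by
  classical
  have hmeas : ∀ n, Measurable[past A X (n + 1)]
      (fun ω => ∏ τ ∈ Finset.Icc 1 n, (if j ∈ (A τ ω).1 then e (X τ ω) else 1)) := by
    intro n
    refine Finset.measurable_fun_prod _ fun τ hτ => ?_
    have hτ' : τ ∈ Finset.Ico 1 (n + 1) := by
      rw [Finset.mem_Icc] at hτ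
      rw [Finset.mem_Ico]
      omega
    exact Measurable.ite (measurableSet_mem_batch_past hτ' j)
      (he.comp (measurable_feedback_past hτ')) measurable_const
  induction n with
  | zero => simp
  | succ n ih =>
    have ht : n + 1 ∈ Finset.Icc 1 T := by rw [Finset.mem_Icc]; omega
    set Z := fun ω => ∏ τ ∈ Finset.Icc 1 n, (if j ∈ (A τ ω).1 then e (X τ ω) else 1) with hZ
    set S : Set Ω := {ω | j ∈ (A (n + 1) ω).1}
    -- Whether j is observed in round n + 1 is decided by the past and the batch, of which the new
    -- feedback is independent.
    have hS : MeasurableSet[past A X (n + 1) ⊔ MeasurableSpace.comap (A (n + 1)) ⊤] S :=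
      (le_sup_right : MeasurableSpace.comap (A (n + 1)) ⊤ ≤
        past A X (n + 1) ⊔ MeasurableSpace.comap (A (n + 1)) ⊤) _ ⟨{B | j ∈ B.1}, trivial, rfl⟩
    have hg : Measurable[MeasurableSpace.comap (X (n + 1)) inferInstance]
        (fun ω => e (X (n + 1) ω)) := he.comp (comap_measurable _)
    have hlaw : ∫⁻ ω, e (X (n + 1) ω) ∂μ ≤ 1 := by
      rw [← h.law_feedback _ ht, lintegral_map he (h.measurable_feedback _ ht)] at hle
      exact hle
    calc ∫⁻ ω, ∏ τ ∈ Finset.Icc 1 (n + 1), (if j ∈ (A τ ω).1 then e (X τ ω) else 1) ∂μ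
        = ∫⁻ ω, (S.indicator Z ω * e (X (n + 1) ω) + Sᶜ.indicator Z ω) ∂μ := by
          refine lintegral_congr fun ω => ?_
          rw [Finset.prod_Icc_succ_top (by omega)]
          by_cases hω : j ∈ (A (n + 1) ω).1
          · have h1 : ω ∈ S := hω
            simp [h1, hω, hZ]
          · have h1 : ω ∉ S := hω
            simp [h1, hω, hZ]
      _ ≤ ∫⁻ ω, Z ω ∂μ := lintegral_indicator_mul_add_le
          (sup_le (h.past_le (by omega)) (h.comap_batch_le ht))
          (h.measurable_feedback _ ht).comap_le (h.indep_feedback _ ht).symm hS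
          ((hmeas n).mono le_sup_left le_rfl) hg hlaw
      _ ≤ 1 := ih (by omega)

/-- Chernoff's bound for the sum of the observations of the arm `j`, on the event that `j` was
played `n` times. -/
theorem IsBCUCB.measure_count_eq_le [IsProbabilityMeasure μ] (h : P.IsBCUCB μ oracle T A X)
    (j : Fin L) {Y : (Fin M → Fin L → ℝ) → ℝ} (hY : Measurable Y) {l ψ x thr : ℝ} (hl : 0 ≤ l)
    (hle : ∫⁻ y, ENNReal.ofReal (Real.exp (l * Y y - ψ)) ∂P.law ≤ 1) {t n : ℕ} (ht : t ≤ T)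
    (hx : x ≤ l * thr - n * ψ) :
    μ {ω | count (fun s => A s ω) j t = n ∧
      thr < ∑ τ ∈ (Finset.Icc 1 t).filter (fun τ => j ∈ (A τ ω).1), Y (X τ ω)}
      ≤ ENNReal.ofReal (Real.exp (-x)) := by
  have hem : Measurable fun y => ENNReal.ofReal (Real.exp (l * Y y - ψ)) := by fun_prop
  have hprod := h.lintegral_prod_le j hem hle ht
  set Z := fun ω => ∏ τ ∈ Finset.Icc 1 t,
    (if j ∈ (A τ ω).1 then ENNReal.ofReal (Real.exp (l * Y (X τ ω) - ψ)) else 1) with hZ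
  have hZm : Measurable Z := by
    refine Finset.measurable_fun_prod _ fun τ hτ => ?_
    have hτ' : τ ∈ Finset.Icc 1 T := by
      rw [Finset.mem_Icc] at hτ ⊢
      omega
    exact Measurable.ite (h.comap_batch_le hτ' _ ⟨{B | j ∈ B.1}, trivial, rfl⟩)
      (hem.comp (h.measurable_feedback τ hτ')) measurable_const
  have hsub : {ω | count (fun s => A s ω) j t = n ∧
      thr < ∑ τ ∈ (Finset.Icc 1 t).filter (fun τ => j ∈ (A τ ω).1), Y (X τ ω)}
      ⊆ {ω | ENNReal.ofReal (Real.exp x) ≤ Z ω} := by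
    rintro ω ⟨h1, h2⟩
    have h3 : Z ω = ENNReal.ofReal (Real.exp (l *
        (∑ τ ∈ (Finset.Icc 1 t).filter (fun τ => j ∈ (A τ ω).1), Y (X τ ω)) - n * ψ)) := by
      simp only [hZ]
      rw [← Finset.prod_filter, ← ENNReal.ofReal_prod_of_nonneg fun _ _ => (Real.exp_pos _).le,
        ← Real.exp_sum, Finset.sum_sub_distrib, Finset.sum_const, ← Finset.mul_sum,
        nsmul_eq_mul]
      rw [count] at h1
      rw [h1]
    rw [Set.mem_ofPred_eq, h3]
    refine ENNReal.ofReal_le_ofReal (Real.exp_le_exp.2 (hx.trans ?_))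
    have := mul_le_mul_of_nonneg_left h2.le hl
    linarith
  refine (measure_mono hsub).trans ((meas_ge_le_lintegral_div hZm.aemeasurable ?_
    ENNReal.ofReal_ne_top).trans ?_)
  · simp [Real.exp_pos]
  · rw [Real.exp_neg, ENNReal.ofReal_inv_of_pos (Real.exp_pos _), ENNReal.div_eq_inv_mul]
    exact mul_le_of_le_one_right' hprod

/-- Union bound over the possible values 1, …, t of the count. The threshold and the pair (l, ψ) may
be tuned to each value. -/
theorem IsBCUCB.measure_count_ne_zero_le [IsProbabilityMeasure μ] (h : P.IsBCUCB μ oracle T A X)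
    (j : Fin L) {Y : (Fin M → Fin L → ℝ) → ℝ} (hY : Measurable Y) {x : ℝ} {thr : ℕ → ℝ} {t : ℕ}
    (ht : t ≤ T)
    (hex : ∀ n : ℕ, 0 < n → ∃ l ψ : ℝ, 0 ≤ l ∧
      ∫⁻ y, ENNReal.ofReal (Real.exp (l * Y y - ψ)) ∂P.law ≤ 1 ∧ x ≤ l * thr n - n * ψ) :
    μ {ω | count (fun s => A s ω) j t ≠ 0 ∧ thr (count (fun s => A s ω) j t)
      < ∑ τ ∈ (Finset.Icc 1 t).filter (fun τ => j ∈ (A τ ω).1), Y (X τ ω)}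
      ≤ t * ENNReal.ofReal (Real.exp (-x)) := by
  have hsub : {ω | count (fun s => A s ω) j t ≠ 0 ∧ thr (count (fun s => A s ω) j t)
      < ∑ τ ∈ (Finset.Icc 1 t).filter (fun τ => j ∈ (A τ ω).1), Y (X τ ω)}
      ⊆ ⋃ n ∈ Finset.Icc 1 t, {ω | count (fun s => A s ω) j t = n ∧ thr n
      < ∑ τ ∈ (Finset.Icc 1 t).filter (fun τ => j ∈ (A τ ω).1), Y (X τ ω)} := by
    rintro ω ⟨h1, h2⟩
    have h3 : count (fun s => A s ω) j t ≤ t := by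
      refine (Finset.card_filter_le _ _).trans ?_
      simp
    exact Set.mem_biUnion (x := count (fun s => A s ω) j t)
      (by rw [Finset.mem_coe, Finset.mem_Icc]; omega) ⟨rfl, h2⟩
  refine (measure_mono hsub).trans ((measure_biUnion_finset_le _ _).trans ?_)
  refine (Finset.sum_le_sum (g := fun _ => ENNReal.ofReal (Real.exp (-x))) ?_).trans ?_
  · intro n hn
    obtain ⟨l, ψ, hl, hle, hx⟩ := hex n (Finset.mem_Icc.1 hn).1
    exact h.measure_count_eq_le j hY hl hle ht hx
  · simp

end SemiBandit

/-- Deviation bounds for the empirical first and second moments control the Empirical-Bernstein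
index from below and above. -/
theorem index_bounds (s : Finset ℕ) (hs : s.card ≠ 0) (y : ℕ → ℝ) {p v l : ℝ}
    (hp1 : p ≤ 1) (hv0 : 0 ≤ v) (hvp : v ≤ p * (1 - p)) (hl : 0 < l)
    (h1 : ∑ τ ∈ s, (p - y τ) ≤ √(2 * s.card * v * (3 * l)) + 3 * l / 3)
    (h2 : ∑ τ ∈ s, (v - (y τ - p) ^ 2) ≤ √(2 * s.card * v * (3 * l)))
    (h3 : ∑ τ ∈ s, (y τ - p) ≤ √(2 * s.card * v * (3 * l)) + 3 * l / 3)
    (h4 : ∑ τ ∈ s, ((y τ - p) ^ 2 - v) ≤ √(2 * s.card * v * (3 * l)) + 3 * l / 3) :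
    let m := 1 / (s.card : ℝ) * ∑ τ ∈ s, y τ
    let V := 1 / (s.card : ℝ) * ∑ τ ∈ s, y τ ^ 2 - m ^ 2
    let q := min 1 (m + √(6 * V * l / s.card) + 9 * l / s.card)
    p ≤ q ∧ q - p ≤ 2 * √6 * √(p * (1 - p)) * √(l / s.card) + 13 * √(l / s.card) ^ 2 := by
  intro m V q
  set N : ℝ := (s.card : ℝ) with hNdef
  have hN : 0 < N := Nat.cast_pos.2 (Nat.pos_of_ne_zero hs)
  set ε := √(l / N) with hεdef
  have hε : 0 < ε := Real.sqrt_pos.2 (by positivity)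
  have hε2 : ε ^ 2 = l / N := Real.sq_sqrt (by positivity)
  set σ := √v with hσdef
  have hσ0 : 0 ≤ σ := Real.sqrt_nonneg _
  have hσ2 : σ ^ 2 = v := Real.sq_sqrt hv0
  have hσ : σ ≤ √(p * (1 - p)) := Real.sqrt_le_sqrt hvp
  have hσ' : σ ≤ 1 / 2 := by
    rw [hσdef, Real.sqrt_le_left (by norm_num)]
    nlinarith [sq_nonneg (p - 1 / 2)]
  have b3 : 2 * √6 * σ * ε ≤ 2 * √6 * √(p * (1 - p)) * ε := by gcongr
  have hlN : 0 ≤ l / N := by positivity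
  have h6s : √6 ^ 2 = 6 := Real.sq_sqrt (by norm_num)
  -- With ε² = l/N and σ² = v this is 6Nvl = (N√6 σε)²; dividing by N turns the hypotheses into
  -- deviations √6 σε + ε².
  have hthr : √(2 * N * v * (3 * l)) = N * (√6 * σ * ε) := by
    have : 2 * N * v * (3 * l) = (N * (√6 * σ * ε)) ^ 2 := by
      rw [mul_pow, mul_pow, mul_pow, h6s, hσ2, hε2]; field_simp; ring
    rw [this, Real.sqrt_sq (by positivity)]
  have hm : ∑ τ ∈ s, y τ = N * m := by
    rw [show m = 1 / N * ∑ τ ∈ s, y τ from rfl]; field_simp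
  have hV : ∑ τ ∈ s, y τ ^ 2 = N * (V + m ^ 2) := by
    rw [show V = 1 / N * ∑ τ ∈ s, y τ ^ 2 - m ^ 2 from rfl]; field_simp; ring
  have hcard : (∑ τ ∈ s, p : ℝ) = N * p := by rw [Finset.sum_const, nsmul_eq_mul]
  have hcardv : (∑ τ ∈ s, v : ℝ) = N * v := by rw [Finset.sum_const, nsmul_eq_mul]
  -- The second moment about p exceeds the empirical variance by (p - m)²; this is the term d² in
  -- `empirical_bernstein_le`.
  have hW : ∑ τ ∈ s, (y τ - p) ^ 2 = N * (V + (p - m) ^ 2) := by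
    have : ∀ τ, (y τ - p) ^ 2 = y τ ^ 2 - 2 * p * y τ + p ^ 2 := fun τ => by ring
    simp only [this]
    rw [Finset.sum_add_distrib, Finset.sum_sub_distrib, ← Finset.mul_sum, hm, hV,
      Finset.sum_const, nsmul_eq_mul]
    ring
  have hl' : l = N * ε ^ 2 := by rw [hε2]; field_simp
  rw [hthr, mul_div_cancel_left₀ _ (by norm_num : (3 : ℝ) ≠ 0), hl'] at h1 h3 h4
  rw [hthr] at h2
  rw [Finset.sum_sub_distrib] at h1 h2 h3 h4
  rw [hcard, hm] at h1 h3
  rw [hcardv, hW] at h2 h4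
  have e1 : p - m ≤ √6 * σ * ε + ε ^ 2 := le_of_mul_le_mul_left (by linarith) hN
  have e3 : m - p ≤ √6 * σ * ε + ε ^ 2 := le_of_mul_le_mul_left (by linarith) hN
  have e2 : σ ^ 2 ≤ V + √6 * σ * ε + (p - m) ^ 2 := by
    rw [hσ2]; exact le_of_mul_le_mul_left (by linarith) hN
  have e4 : V ≤ σ ^ 2 + √6 * σ * ε + ε ^ 2 := by
    have : V + (p - m) ^ 2 ≤ σ ^ 2 + √6 * σ * ε + ε ^ 2 := by
      rw [hσ2]; exact le_of_mul_le_mul_left (by linarith) hN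
    linarith [sq_nonneg (p - m)]
  have hq : q = min 1 (m + √6 * √V * ε + 9 * ε ^ 2) := by
    have a1 : √(6 * V * l / N) = √6 * √V * ε := by
      rw [hεdef, mul_div_assoc, Real.sqrt_mul' _ hlN, Real.sqrt_mul (by norm_num)]
    simp only [q]
    rw [a1, hε2, mul_div_assoc]
  rw [hq]
  constructor
  · refine le_min hp1 ?_
    have := empirical_bernstein_le hσ0 hσ' hε e1 e2
    linarith
  · have b1 := empirical_bernstein_width hσ0 hε.le e3 e4
    have b2 := min_le_right 1 (m + √6 * √V * ε + 9 * ε ^ 2)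
    linarith

namespace SemiBandit

variable {L M : ℕ} {P : SemiBandit L M} {Ω : Type*} {A : ℕ → Ω → P.actions}
  {X : ℕ → Ω → Fin M → Fin L → ℝ} [mΩ : MeasurableSpace Ω] {μ : Measure Ω}
  {oracle : (Fin M → Fin L → ℝ) → PMF P.actions} {T : ℕ}

/-- The index of the entry `(i, j)` in round `t` is optimistic and has a small width. -/
def IsGoodIndex (P : SemiBandit L M) (a : ℕ → P.actions) (x : ℕ → Fin M → Fin L → ℝ) (t : ℕ)
    (i : Fin M) (j : Fin L) : Prop :=
  P.mean i j ≤ ucbIndex a x t i j ∧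
    ucbIndex a x t i j - P.mean i j ≤ 2 * √6 * √(P.mean i j * (1 - P.mean i j))
      * √(Real.log t / count a j (t - 1)) + 13 * √(Real.log t / count a j (t - 1)) ^ 2

theorem mean_mem_Icc [IsProbabilityMeasure P.law]
    (hlaw : ∀ᵐ x ∂P.law, ∀ i j, x i j ∈ Set.Icc (0 : ℝ) 1) (i : Fin M) (j : Fin L) :
    P.mean i j ∈ Set.Icc (0 : ℝ) 1 :=
  integral_mem_Icc (ξ := fun x : Fin M → Fin L → ℝ => x i j) (by fun_prop)
    (hlaw.mono fun x hx => hx i j)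

/-- Outside four deviation events `index_bounds` applies. Each event has probability at most
(t-1)·t⁻³ ≤ t⁻², and t ≥ 2 makes log t positive. -/
theorem IsBCUCB.measure_not_isGoodIndex_le [IsProbabilityMeasure μ] [IsProbabilityMeasure P.law]
    (h : P.IsBCUCB μ oracle T A X) (hlaw : ∀ᵐ x ∂P.law, ∀ i j, x i j ∈ Set.Icc (0 : ℝ) 1)
    (i : Fin M) (j : Fin L) {t : ℕ} (ht : t ≤ T) (ht2 : 2 ≤ t) :
    μ {ω | count (fun s => A s ω) j (t - 1) ≠ 0 ∧
      ¬ P.IsGoodIndex (fun s => A s ω) (fun s => X s ω) t i j} ≤ ENNReal.ofReal (4 / t ^ 2) := by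
  set ξ : (Fin M → Fin L → ℝ) → ℝ := fun x => x i j with hξ
  have hξm : Measurable ξ := by fun_prop
  have hξI : ∀ᵐ x ∂P.law, ξ x ∈ Set.Icc (0 : ℝ) 1 := hlaw.mono fun x hx => hx i j
  have hξi := integrable_of_mem_Icc hξm hξI
  set p := P.mean i j with hp
  have hpξ : ∫ x, ξ x ∂P.law = p := rfl
  have hpI : p ∈ Set.Icc (0 : ℝ) 1 := mean_mem_Icc hlaw i j
  set v := ∫ x, (ξ x - p) ^ 2 ∂P.law with hv
  have hv0 : 0 ≤ v := integral_nonneg fun x => sq_nonneg _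
  have hvp : v ≤ p * (1 - p) := by
    have := integral_sub_sq_le hξm hξI
    rwa [hpξ] at this
  have hlog : 0 < Real.log t := Real.log_pos (by exact_mod_cast ht2)
  have hx : 0 < 3 * Real.log t := by linarith
  have habs : ∀ᵐ x ∂P.law, |ξ x - p| ≤ 1 := by
    filter_upwards [hξI] with x hx
    rw [abs_le]
    constructor <;> linarith [hx.1, hx.2, hpI.1, hpI.2]
  have hsqI : ∀ᵐ x ∂P.law, (ξ x - p) ^ 2 ∈ Set.Icc (0 : ℝ) 1 := by
    filter_upwards [habs] with x hx
    exact ⟨sq_nonneg _, (sq_le_one_iff_abs_le_one _).2 hx⟩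
  have hsqm : Measurable fun x => (ξ x - p) ^ 2 := by fun_prop
  have hsqi := integrable_of_mem_Icc hsqm hsqI
  have h4i : Integrable (fun x => ((ξ x - p) ^ 2) ^ 2) P.law := by
    refine integrable_of_mem_Icc (a := 0) (b := 1) (by fun_prop) ?_
    filter_upwards [hsqI] with x hx
    exact ⟨sq_nonneg _, pow_le_one₀ hx.1 hx.2⟩
  have h4 : ∫ x, ((ξ x - p) ^ 2) ^ 2 ∂P.law ≤ v := by
    refine integral_mono_ae h4i hsqi ?_
    filter_upwards [hsqI] with x hx
    exact pow_le_of_le_one hx.1 hx.2 two_ne_zero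
  have ht' : t - 1 ≤ T := by omega
  -- the four deviation events
  have b1 := h.measure_count_ne_zero_le j (Y := fun x => p - ξ x) (by fun_prop)
    (x := 3 * Real.log t) (thr := fun n => √(2 * n * v * (3 * Real.log t)) + 3 * Real.log t / 3)
    ht' fun n hn => by
      refine exists_exp_moment_bernstein (by fun_prop) ?_ ?_ ?_ hx hn
      · rw [integral_sub (integrable_const _) hξi, hpξ]
        simp
      · filter_upwards [habs] with x hx
        rwa [abs_sub_comm]
      · rw [hv]
        exact le_of_eq (integral_congr_ae (.of_forall fun x => by ring))
  have b3 := h.measure_count_ne_zero_le j (Y := fun x => ξ x - p) (by fun_prop)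
    (x := 3 * Real.log t) (thr := fun n => √(2 * n * v * (3 * Real.log t)) + 3 * Real.log t / 3)
    ht' fun n hn => by
      refine exists_exp_moment_bernstein (by fun_prop) ?_ habs le_rfl hx hn
      rw [integral_sub hξi (integrable_const _), hpξ]
      simp
  have b4 := h.measure_count_ne_zero_le j (Y := fun x => (ξ x - p) ^ 2 - v) (by fun_prop)
    (x := 3 * Real.log t) (thr := fun n => √(2 * n * v * (3 * Real.log t)) + 3 * Real.log t / 3)
    ht' fun n hn => by
      refine exists_exp_moment_bernstein (by fun_prop) ?_ ?_ ?_ hx hn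
      · rw [integral_sub hsqi (integrable_const _), ← hv]
        simp
      · have hv1 : v ≤ 1 := by nlinarith [hpI.1, hpI.2]
        filter_upwards [hsqI] with x hx
        rw [abs_le]
        constructor <;> linarith [hx.1, hx.2]
      -- The variance of (ξ - p)² is E(ξ - p)⁴ - v², and the fourth moment is at most v because |ξ -
      -- p| ≤ 1.
      · have e : ∀ x, ((ξ x - p) ^ 2 - v) ^ 2
            = ((ξ x - p) ^ 2) ^ 2 + ((-(2 * v)) * (ξ x - p) ^ 2 + v ^ 2) := fun x => by ring
        have i1 : Integrable (fun x => (-(2 * v)) * (ξ x - p) ^ 2) P.law := hsqi.const_mul _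
        have i2 : Integrable (fun x => (-(2 * v)) * (ξ x - p) ^ 2 + v ^ 2) P.law :=
          i1.add (integrable_const _)
        simp only [e]
        rw [integral_add h4i i2, integral_add i1 (integrable_const _), integral_const_mul, ← hv]
        simp only [integral_const, probReal_univ, smul_eq_mul]
        nlinarith [sq_nonneg v]
  have b2 : μ {ω | count (fun s => A s ω) j (t - 1) ≠ 0 ∧
      √(2 * (count (fun s => A s ω) j (t - 1) : ℕ) * v * (3 * Real.log t))
      < ∑ τ ∈ (Finset.Icc 1 (t - 1)).filter (fun τ => j ∈ (A τ ω).1), (v - (ξ (X τ ω) - p) ^ 2)}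
      ≤ (t - 1 : ℕ) * ENNReal.ofReal (Real.exp (-(3 * Real.log t))) := by
    -- For v = 0 the summands are nonpositive and the event is empty; the sub-Gaussian lemma needs v
    -- > 0.
    rcases hv0.eq_or_lt with hz | hvpos
    · refine (measure_mono_null (t := ∅) ?_ measure_empty).trans_le zero_le
      rintro ω ⟨-, hω⟩
      refine absurd hω (not_lt.2 ?_)
      refine (Finset.sum_nonpos fun τ _ => ?_).trans (Real.sqrt_nonneg _)
      rw [← hz]
      linarith [sq_nonneg (ξ (X τ ω) - p)]
    · exact h.measure_count_ne_zero_le j (Y := fun x => v - (ξ x - p) ^ 2) (by fun_prop)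
        (x := 3 * Real.log t) (thr := fun n => √(2 * n * v * (3 * Real.log t)))
        ht' fun n hn => exists_exp_moment_of_nonneg hsqm (fun x => sq_nonneg _)
          (hsqI.mono fun x hx => hx.2) h4 hvpos hx hn
  have hbound : (t - 1 : ℕ) * ENNReal.ofReal (Real.exp (-(3 * Real.log t)))
      ≤ ENNReal.ofReal (1 / t ^ 2) := by
    have htpos : (0 : ℝ) < t := by exact_mod_cast (by omega : 0 < t)
    have e1 : Real.exp (-(3 * Real.log t)) = 1 / (t : ℝ) ^ 3 := by
      rw [Real.exp_neg, show 3 * Real.log t = Real.log ((t : ℝ) ^ 3) by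
        rw [Real.log_pow]; norm_num, Real.exp_log (by positivity), one_div]
    rw [e1, ← ENNReal.ofReal_natCast, ← ENNReal.ofReal_mul (Nat.cast_nonneg _)]
    refine ENNReal.ofReal_le_ofReal ?_
    have e2 : ((t - 1 : ℕ) : ℝ) ≤ t := by exact_mod_cast Nat.sub_le t 1
    calc _ ≤ (t : ℝ) * (1 / t ^ 3) := by gcongr
      _ = 1 / t ^ 2 := by field_simp
  have hU := (measure_union_le _ _).trans ((add_le_add (b1.trans hbound)
    ((measure_union_le _ _).trans (add_le_add (b2.trans hbound)
    ((measure_union_le _ _).trans (add_le_add (b3.trans hbound) (b4.trans hbound)))))))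
  refine (measure_mono ?_).trans (hU.trans ?_)
  · rintro ω ⟨hN, hbad⟩
    by_contra hcon
    simp only [Set.mem_union, Set.mem_ofPred_eq, not_or, not_and, not_lt] at hcon
    obtain ⟨c1, c2, c3, c4⟩ := hcon
    refine hbad ?_
    have := index_bounds ((Finset.Icc 1 (t - 1)).filter (fun τ => j ∈ (A τ ω).1)) hN
      (fun τ => X τ ω i j) hpI.2 hv0 hvp hlog (c1 hN) (c2 hN) (c3 hN) (c4 hN)
    exact this
  · rw [← ENNReal.ofReal_add (by positivity) (by positivity),
      ← ENNReal.ofReal_add (by positivity) (by positivity),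
      ← ENNReal.ofReal_add (by positivity) (by positivity)]
    refine ENNReal.ofReal_le_ofReal (le_of_eq ?_)
    ring

/-- The bad event of round `t`: all arms have been played, but some index is not good. -/
def badEvent (A : ℕ → Ω → P.actions) (X : ℕ → Ω → Fin M → Fin L → ℝ) (t : ℕ) : Set Ω :=
  {ω | (∀ j, count (fun s => A s ω) j (t - 1) ≠ 0) ∧
    ¬ ∀ i j, P.IsGoodIndex (fun s => A s ω) (fun s => X s ω) t i j}

theorem IsBCUCB.measure_badEvent_le [IsProbabilityMeasure μ] [IsProbabilityMeasure P.law]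
    (h : P.IsBCUCB μ oracle T A X) (hlaw : ∀ᵐ x ∂P.law, ∀ i j, x i j ∈ Set.Icc (0 : ℝ) 1)
    {t : ℕ} (ht : t ∈ Finset.Icc 1 T) :
    μ (badEvent A X t) ≤ ENNReal.ofReal (M * L * (4 / t ^ 2)) := by
  rw [Finset.mem_Icc] at ht
  -- Before round 1 every count is 0, so the existence of a bad entry already contradicts
  -- exploration.
  rcases ht.1.eq_or_lt with rfl | ht2
  · refine (measure_mono_null (t := ∅) ?_ measure_empty).trans_le zero_le
    rintro ω ⟨h1, h2⟩
    push Not at h2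
    obtain ⟨i, j, -⟩ := h2
    exact h1 j (count_zero _ j)
  · have hsub : badEvent A X t ⊆ ⋃ i : Fin M, ⋃ j : Fin L,
        {ω | count (fun s => A s ω) j (t - 1) ≠ 0 ∧
          ¬ P.IsGoodIndex (fun s => A s ω) (fun s => X s ω) t i j} := by
      rintro ω ⟨h1, h2⟩
      push Not at h2
      obtain ⟨i, j, hij⟩ := h2
      exact Set.mem_iUnion₂.2 ⟨i, j, h1 j, hij⟩
    refine (measure_mono hsub).trans ((measure_iUnion_fintype_le μ _).trans ?_)
    refine (Finset.sum_le_sum (g := fun _ => (L : ENNReal) * ENNReal.ofReal (4 / t ^ 2))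
      fun i _ => ?_).trans ?_
    · refine (measure_iUnion_fintype_le μ _).trans ((Finset.sum_le_sum
        (g := fun _ => ENNReal.ofReal (4 / t ^ 2)) fun j _ =>
          h.measure_not_isGoodIndex_le hlaw i j ht.2 ht2).trans ?_)
      simp
    · rw [ENNReal.ofReal_mul (by positivity), ENNReal.ofReal_mul (by positivity)]
      simp [mul_assoc]

end SemiBandit

/-! ### The gap in a good round -/

namespace MonotonicGiniSmooth

variable {L : ℕ} {𝒜 : Finset (Finset (Fin L))} {f : 𝒜 → (Fin L → ℝ) → ℝ} {γinf γg : ℝ}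

theorem half_mem_openCube : (fun _ => 1 / 2 : Fin L → ℝ) ∈ openCube L := fun j => by
  constructor <;> norm_num

theorem γg_nonneg (hf : MonotonicGiniSmooth f γinf γg) (A : 𝒜) : 0 ≤ γg :=
  (Real.sqrt_nonneg _).trans (hf.gini A _ half_mem_openCube)

theorem γinf_nonneg (hf : MonotonicGiniSmooth f γinf γg) {A : 𝒜} {j : Fin L} (hj : j ∈ A.1) :
    0 ≤ γinf :=
  (hf.deriv_mem A j hj _ half_mem_openCube).1.trans (hf.deriv_mem A j hj _ half_mem_openCube).2

end MonotonicGiniSmooth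

namespace SemiBandit

variable {L M : ℕ} {P : SemiBandit L M} {γinf γg α β : ℝ}

theorem reward_nonneg (hw : ∀ i, 0 ≤ P.w i) (hr : ∀ i A, ∀ x ∈ closedCube L, 0 ≤ P.r i A x)
    (B : P.actions) {q : Fin M → Fin L → ℝ} (hq : ∀ i, q i ∈ closedCube L) : 0 ≤ P.reward B q :=
  Finset.sum_nonneg fun i _ => mul_nonneg (hw i) (hr i B _ (hq i))

theorem reward_le_optValue (B : P.actions) (q : Fin M → Fin L → ℝ) :
    P.reward B q ≤ P.optValue q :=
  le_ciSup (f := fun A => P.reward A q) (Set.finite_range _).bddAbove B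

/-- The parameters in the unit cube for which the batch `B` is an `α`-approximate optimum. -/
def approxOptSet (P : SemiBandit L M) (α : ℝ) (B : P.actions) : Set (Fin M → Fin L → ℝ) :=
  {q | (∀ i, q i ∈ closedCube L) ∧ ∀ A', α * P.reward A' q ≤ P.reward B q}

theorem mem_approxOptSet (hα : 0 ≤ α) {B : P.actions} {q : Fin M → Fin L → ℝ}
    (hq : ∀ i, q i ∈ closedCube L) (h : α * P.optValue q ≤ P.reward B q) :
    q ∈ P.approxOptSet α B :=
  ⟨hq, fun A' => (mul_le_mul_of_nonneg_left (reward_le_optValue A' q) hα).trans h⟩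

theorem isClosed_closedCube (L : ℕ) : IsClosed (closedCube L) := by
  have : closedCube L = Set.univ.pi fun _ => Set.Icc (0 : ℝ) 1 := by
    ext x
    simp only [closedCube, Set.mem_univ_pi, Set.mem_ofPred_eq]
  rw [this]
  exact isClosed_set_pi fun _ _ => isClosed_Icc

theorem continuousOn_reward (hsmooth : ∀ i, MonotonicGiniSmooth (P.r i) γinf γg)
    (B : P.actions) :
    ContinuousOn (P.reward B) {q | ∀ i, q i ∈ closedCube L} := by
  unfold reward
  refine continuousOn_finsetSum _ fun i _ => continuousOn_const.mul ?_
  exact ((hsmooth i).continuous B).comp (continuous_apply i).continuousOn fun q hq => hq i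

/-- Rewards are continuous only on the closed cube. With the cube built in, the set is an
intersection of relatively closed subsets of a closed set. -/
theorem measurableSet_approxOptSet (hsmooth : ∀ i, MonotonicGiniSmooth (P.r i) γinf γg)
    (B : P.actions) : MeasurableSet (P.approxOptSet α B) := by
  have hC : IsClosed {q : Fin M → Fin L → ℝ | ∀ i, q i ∈ closedCube L} := by
    simp only [Set.ofPred_forall]
    exact isClosed_iInter fun i => (isClosed_closedCube L).preimage (continuous_apply i)
  have : P.approxOptSet α B = ⋂ A', {q ∈ {q : Fin M → Fin L → ℝ | ∀ i, q i ∈ closedCube L} |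
      α * P.reward A' q ≤ P.reward B q} := by
    ext q
    simp only [approxOptSet, Set.mem_iInter, Set.mem_ofPred_eq]
    exact ⟨fun h A' => ⟨h.1, h.2 A'⟩, fun h => ⟨(h B).1, fun A' => (h A').2⟩⟩
  rw [this]
  exact (isClosed_iInter fun A' => hC.isClosed_le
    (continuousOn_const.mul (continuousOn_reward hsmooth A'))
    (continuousOn_reward hsmooth B)).measurableSet

/-- In a round with good indices, the gap of an approximately optimal batch is controlled by the
confidence widths of its arms. -/
theorem gap_sq_le [IsProbabilityMeasure P.law]
    (hlaw : ∀ᵐ x ∂P.law, ∀ i j, x i j ∈ Set.Icc (0 : ℝ) 1) (hw : ∀ i, 0 ≤ P.w i)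
    (hsmooth : ∀ i, MonotonicGiniSmooth (P.r i) γinf γg) (hα : 0 ≤ α)
    {a : ℕ → P.actions} {x : ℕ → Fin M → Fin L → ℝ} {t T : ℕ} (ht : 1 ≤ t) (htT : t ≤ T)
    (hgood : ∀ i j, P.IsGoodIndex a x t i j) {B : P.actions}
    (hB : ucbIndex a x t ∈ P.approxOptSet α B) (hgap : 0 < P.gap α B) :
    P.gap α B ^ 2 ≤ (9 * Real.pi * P.totalWeight * γg) ^ 2 * Real.log T
      * ∑ j ∈ B.1, 1 / (count a j (t - 1) : ℝ) := by
  set q := ucbIndex a x t with hqdef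
  set S := ∑ j ∈ B.1, 1 / (count a j (t - 1) : ℝ) with hS
  have hS0 : 0 ≤ S := Finset.sum_nonneg fun j _ => by positivity
  have hlogT : 0 ≤ Real.log T := Real.log_natCast_nonneg T
  have hlogt : 0 ≤ Real.log t := Real.log_natCast_nonneg t
  have hlog : Real.log t ≤ Real.log T :=
    Real.log_le_log (by exact_mod_cast ht) (by exact_mod_cast htT)
  have hp : ∀ i, P.mean i ∈ closedCube L := fun i j => mean_mem_Icc hlaw i j
  have hpq : ∀ i j, P.mean i j ≤ q i j := fun i j => (hgood i j).1
  have : Nonempty P.actions := ⟨B⟩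
  -- Optimism: monotonicity gives α r(A';p) ≤ α r(A';q) for every A', and B is α-optimal for q.
  have h1 : α * P.rMax ≤ P.reward B q := by
    rw [rMax, optValue, Real.mul_iSup_of_nonneg hα]
    refine ciSup_le fun A' => le_trans ?_ (hB.2 A')
    refine mul_le_mul_of_nonneg_left (Finset.sum_le_sum fun i _ => ?_) hα
    exact mul_le_mul_of_nonneg_left ((hsmooth i).mono A' (hp i) (hB.1 i) (hpq i)) (hw i)
  have h2 : ∀ i, P.r i B (q i) - P.r i B (P.mean i)
      ≤ 9 * Real.pi * γg * √(Real.log T * S) := by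
    intro i
    refine ((hsmooth i).sub_le_arcsin B (hp i) (hB.1 i)).trans ?_
    have hγ := (hsmooth i).γg_nonneg B
    have h3 : ∑ j ∈ B.1, (Real.arcsin √(q i j) - Real.arcsin √(P.mean i j)) ^ 2
        ≤ (9 * Real.pi / 2) ^ 2 * (Real.log T * S) := by
      rw [hS, Finset.mul_sum, Finset.mul_sum]
      refine Finset.sum_le_sum fun j _ => ?_
      have h4 := arcsin_sqrt_sub_le (hp i j).1 (hB.1 i j).2 (hpq i j) (Real.sqrt_nonneg _)
        (hgood i j).2
      have h5 : 0 ≤ Real.arcsin √(q i j) - Real.arcsin √(P.mean i j) :=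
        sub_nonneg.2 (Real.monotone_arcsin (Real.sqrt_le_sqrt (hpq i j)))
      refine (pow_le_pow_left₀ h5 h4 2).trans ?_
      rw [mul_pow, Real.sq_sqrt (by positivity), div_eq_mul_one_div (Real.log t)]
      gcongr
    calc 2 * γg * √(∑ j ∈ B.1, (Real.arcsin √(q i j) - Real.arcsin √(P.mean i j)) ^ 2)
        ≤ 2 * γg * √((9 * Real.pi / 2) ^ 2 * (Real.log T * S)) := by gcongr
      _ = 9 * Real.pi * γg * √(Real.log T * S) := by
        rw [Real.sqrt_mul (by positivity), Real.sqrt_sq (by positivity)]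
        ring
  have h3 : P.gap α B ≤ 9 * Real.pi * P.totalWeight * γg * √(Real.log T * S) := by
    calc P.gap α B ≤ P.reward B q - P.reward B P.mean := by rw [gap]; linarith
      _ = ∑ i, P.w i * (P.r i B (q i) - P.r i B (P.mean i)) := by
        rw [reward, reward, ← Finset.sum_sub_distrib]
        exact Finset.sum_congr rfl fun i _ => by ring
      _ ≤ ∑ i, P.w i * (9 * Real.pi * γg * √(Real.log T * S)) :=
        Finset.sum_le_sum fun i _ => mul_le_mul_of_nonneg_left (h2 i) (hw i)
      _ = _ := by rw [← Finset.sum_mul, totalWeight]; ring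
  refine (pow_le_pow_left₀ hgap.le h3 2).trans (le_of_eq ?_)
  rw [mul_pow, Real.sq_sqrt (by positivity)]
  ring

/-! ### Measurability and the success of the oracle -/

section Measurability

variable {Ω : Type*} [MeasurableSpace Ω] {A : ℕ → Ω → P.actions}
  {X : ℕ → Ω → Fin M → Fin L → ℝ} {t : ℕ}

theorem measurable_count (hA : ∀ s ∈ Finset.Icc 1 t, ∀ j, MeasurableSet {ω | j ∈ (A s ω).1})
    (j : Fin L) : Measurable fun ω => count (fun s => A s ω) j t := by
  simp only [count, Finset.card_filter]
  exact Finset.measurable_fun_sum _ fun s hs =>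
    Measurable.ite (hA s hs j) measurable_const measurable_const

theorem measurable_sum_observed (hX : ∀ s ∈ Finset.Icc 1 t, Measurable (X s))
    (hA : ∀ s ∈ Finset.Icc 1 t, ∀ j, MeasurableSet {ω | j ∈ (A s ω).1}) (j : Fin L)
    {f : (Fin M → Fin L → ℝ) → ℝ} (hf : Measurable f) :
    Measurable fun ω =>
      ∑ τ ∈ (Finset.Icc 1 t).filter (fun τ => j ∈ (A τ ω).1), f (X τ ω) := by
  simp only [Finset.sum_filter]
  exact Finset.measurable_fun_sum _ fun s hs =>
    Measurable.ite (hA s hs j) (hf.comp (hX s hs)) measurable_const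

theorem measurable_ucbIndex (hX : ∀ s ∈ Finset.Icc 1 (t - 1), Measurable (X s))
    (hA : ∀ s ∈ Finset.Icc 1 (t - 1), ∀ j, MeasurableSet {ω | j ∈ (A s ω).1}) :
    Measurable fun ω => ucbIndex (fun s => A s ω) (fun s => X s ω) t := by
  refine measurable_pi_lambda _ fun i => measurable_pi_lambda _ fun j => ?_
  have hN : Measurable fun ω => (count (fun s => A s ω) j (t - 1) : ℝ) :=
    measurable_from_top.comp (measurable_count hA j)
  have h1 := measurable_sum_observed hX hA j (f := fun x => x i j) (by fun_prop)
  have h2 := measurable_sum_observed hX hA j (f := fun x => x i j ^ 2) (by fun_prop)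
  unfold ucbIndex empVar empMean
  fun_prop

end Measurability

variable {Ω : Type*} {A : ℕ → Ω → P.actions} {X : ℕ → Ω → Fin M → Fin L → ℝ}

/-- All arms have been played before round `t`. -/
def explored (A : ℕ → Ω → P.actions) (t : ℕ) : Set Ω :=
  {ω | ∀ j, count (fun s => A s ω) j (t - 1) ≠ 0}

/-- All arms have been played before round `t`, and in round `t` the oracle succeeds. -/
def oracleSuccess (α : ℝ) (A : ℕ → Ω → P.actions) (X : ℕ → Ω → Fin M → Fin L → ℝ) (t : ℕ) :
    Set Ω :=
  {ω | ω ∈ explored A t ∧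
    ucbIndex (fun s => A s ω) (fun s => X s ω) t ∈ P.approxOptSet α (A t ω)}

theorem mem_Ico_of_mem_Icc_pred {s t : ℕ} (hs : s ∈ Finset.Icc 1 (t - 1)) :
    s ∈ Finset.Ico 1 t := by
  rw [Finset.mem_Icc] at hs
  rw [Finset.mem_Ico]
  omega

theorem measurableSet_explored_past (t : ℕ) : MeasurableSet[past A X t] (explored A t) := by
  let _ := past A X t
  simp only [explored, Set.ofPred_forall]
  refine MeasurableSet.iInter fun j => ?_
  exact (measurable_count (fun s hs j =>
    measurableSet_mem_batch_past (mem_Ico_of_mem_Icc_pred hs) j) j)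
    (measurableSet_singleton 0).compl

theorem measurable_ucbIndex_past (t : ℕ) :
    Measurable[past A X t] fun ω => ucbIndex (fun s => A s ω) (fun s => X s ω) t := by
  let _ := past A X t
  exact measurable_ucbIndex
    (fun s hs => measurable_feedback_past (mem_Ico_of_mem_Icc_pred hs))
    (fun s hs j => measurableSet_mem_batch_past (mem_Ico_of_mem_Icc_pred hs) j)

theorem ucbIndex_mem_closedCube {a : ℕ → P.actions} {x : ℕ → Fin M → Fin L → ℝ} {t : ℕ}
    (hx : ∀ s ∈ Finset.Icc 1 (t - 1), ∀ i j, 0 ≤ x s i j) (i : Fin M) :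
    ucbIndex a x t i ∈ closedCube L := by
  intro j
  refine ⟨le_min zero_le_one ?_, min_le_left _ _⟩
  have h1 : 0 ≤ empMean a x i j (t - 1) := mul_nonneg (by positivity)
    (Finset.sum_nonneg fun s hs => hx s (Finset.mem_filter.1 hs).1 i j)
  have h2 : 0 ≤ Real.log t := Real.log_natCast_nonneg t
  positivity

/-- Splitting by the played batch isolates a factor that depends only on the past; over it the
conditional probability of `A t = B` can be integrated. -/
theorem oracleSuccess_eq (t : ℕ) : oracleSuccess α A X t
    = ⋃ B, (explored A t ∩ (fun ω => ucbIndex (fun s => A s ω) (fun s => X s ω) t) ⁻¹'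
        P.approxOptSet α B) ∩ A t ⁻¹' {B} := by
  ext ω
  simp only [oracleSuccess, Set.mem_iUnion, Set.mem_inter_iff, Set.mem_preimage,
    Set.mem_singleton_iff, Set.mem_ofPred_eq]
  constructor
  · rintro ⟨h1, h2⟩
    exact ⟨_, ⟨h1, h2⟩, rfl⟩
  · rintro ⟨_, ⟨h1, h2⟩, rfl⟩
    exact ⟨h1, h2⟩

theorem measurableSet_explored_inter_past
    (hsmooth : ∀ i, MonotonicGiniSmooth (P.r i) γinf γg) (t : ℕ) (B : P.actions) :
    MeasurableSet[past A X t] (explored A t ∩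
      (fun ω => ucbIndex (fun s => A s ω) (fun s => X s ω) t) ⁻¹' P.approxOptSet α B) :=
  MeasurableSet.inter (measurableSet_explored_past t)
    (measurable_ucbIndex_past t (measurableSet_approxOptSet hsmooth B))

variable [mΩ : MeasurableSpace Ω] {μ : Measure Ω} {oracle : (Fin M → Fin L → ℝ) → PMF P.actions}
  {T : ℕ}

theorem IsBCUCB.measurable_comp_batch (h : P.IsBCUCB μ oracle T A X) {t : ℕ}
    (ht : t ∈ Finset.Icc 1 T) (f : P.actions → ℝ) : Measurable fun ω => f (A t ω) := by
  intro s _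
  exact h.comap_batch_le ht _ ⟨f ⁻¹' s, trivial, rfl⟩

theorem IsBCUCB.integrable_comp_batch [IsProbabilityMeasure μ] (h : P.IsBCUCB μ oracle T A X)
    {t : ℕ} (ht : t ∈ Finset.Icc 1 T) (f : P.actions → ℝ) :
    Integrable (fun ω => f (A t ω)) μ := by
  refine Integrable.of_bound (h.measurable_comp_batch ht f).aestronglyMeasurable
    (∑ B, |f B|) (.of_forall fun ω => ?_)
  exact Finset.single_le_sum (f := fun B => |f B|) (fun B _ => abs_nonneg _) (Finset.mem_univ _)

theorem IsBCUCB.measurableSet_oracleSuccess (h : P.IsBCUCB μ oracle T A X)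
    (hsmooth : ∀ i, MonotonicGiniSmooth (P.r i) γinf γg) {t : ℕ} (ht : t ∈ Finset.Icc 1 T) :
    MeasurableSet (oracleSuccess α A X t) := by
  rw [oracleSuccess_eq]
  have hle : past A X t ≤ mΩ := h.past_le (by have := (Finset.mem_Icc.1 ht).2; omega)
  exact MeasurableSet.iUnion fun B => (hle _ (measurableSet_explored_inter_past hsmooth t B)).inter
    (h.measurable_batch t ht B)

/-- Given that all arms have been played, the oracle succeeds with probability at least `β`. -/
theorem IsBCUCB.le_measure_oracleSuccess [IsProbabilityMeasure μ]
    (h : P.IsBCUCB μ oracle T A X)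
    (hlaw : ∀ᵐ x ∂P.law, ∀ i j, x i j ∈ Set.Icc (0 : ℝ) 1)
    (hsmooth : ∀ i, MonotonicGiniSmooth (P.r i) γinf γg) (hα : 0 ≤ α)
    (horacle : P.IsApproxOracle α β oracle) {t : ℕ} (ht : t ∈ Finset.Icc 1 T) :
    β * μ.real (explored A t) ≤ μ.real (oracleSuccess α A X t) := by
  classical
  have htT := Finset.mem_Icc.1 ht
  have hle : past A X t ≤ mΩ := h.past_le (by omega)
  set q := fun ω => ucbIndex (fun s => A s ω) (fun s => X s ω) t with hq
  set S : P.actions → Set Ω := fun B => explored A t ∩ q ⁻¹' P.approxOptSet α B with hSdef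
  have hSm : ∀ B, MeasurableSet[past A X t] (S B) := measurableSet_explored_inter_past hsmooth t
  set c : P.actions → Ω → ℝ :=
    fun B => μ[(A t ⁻¹' {B}).indicator (fun _ => (1 : ℝ)) | past A X t] with hc
  have hci : ∀ B, Integrable (c B) μ := fun B => integrable_condExp
  have hreal : ∀ B, μ.real (S B ∩ A t ⁻¹' {B}) = ∫ ω in S B, c B ω ∂μ := by
    intro B
    have hBm := h.measurable_batch t ht B
    rw [setIntegral_condExp hle ((integrable_const 1).indicator hBm) (hSm B),
      setIntegral_indicator hBm]
    simp
  have hcube : ∀ᵐ ω ∂μ, ∀ i, q ω i ∈ closedCube L := by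
    have : ∀ᵐ ω ∂μ, ∀ s ∈ Finset.Icc 1 (t - 1), ∀ i j, X s ω i j ∈ Set.Icc (0 : ℝ) 1 := by
      rw [Filter.eventually_all_finset]
      intro s hs
      have hs' : s ∈ Finset.Icc 1 T := by
        rw [Finset.mem_Icc] at hs ⊢
        omega
      rw [← h.law_feedback s hs'] at hlaw
      exact ae_of_ae_map (h.measurable_feedback s hs').aemeasurable hlaw
    filter_upwards [this] with ω hω
    exact ucbIndex_mem_closedCube fun s hs i j => (hω s hs i j).1
  have hsum : μ.real (oracleSuccess α A X t) = ∑ B, ∫ ω in S B, c B ω ∂μ := by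
    rw [oracleSuccess_eq, measureReal_iUnion_fintype]
    · exact Finset.sum_congr rfl fun B _ => hreal B
    · intro B B' hne
      refine Set.disjoint_left.2 fun ω h1 h2 => hne ?_
      exact (show A t ω = B from h1.2).symm.trans h2.2
    · exact fun B => (hle _ (hSm B)).inter (h.measurable_batch t ht B)
  have hI : ∀ B, Integrable ((S B).indicator (c B)) μ := fun B => (hci B).indicator (hle _ (hSm B))
  have hOm : MeasurableSet (explored A t) := hle _ (measurableSet_explored_past t)
  have hβ : β * μ.real (explored A t) = ∫ ω, (explored A t).indicator (fun _ => β) ω ∂μ := by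
    rw [integral_indicator hOm]
    simp [mul_comm]
  rw [hsum, hβ]
  simp_rw [← integral_indicator (hle _ (hSm _))]
  rw [← integral_finsetSum _ fun B _ => hI B]
  refine integral_mono_ae ((integrable_const β).indicator hOm)
    (integrable_finsetSum _ fun B _ => hI B) ?_
  have hstep : ∀ᵐ ω ∂μ, ∀ B, (∀ j, count (fun s => A s ω) j (t - 1) ≠ 0) →
      c B ω = (oracle (q ω) B).toReal := by
    rw [ae_all_iff]
    exact fun B => h.oracle_step t ht B
  filter_upwards [hcube, hstep] with ω h1 h2
  by_cases hω : ω ∈ explored A t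
  · rw [Set.indicator_of_mem hω]
    have h3 := horacle (q ω) h1
    rw [PMF.toOuterMeasure_apply_fintype] at h3
    -- Every batch that is α-optimal for q(ω) contributes its full oracle probability, so the sum is
    -- at least β pointwise on the explored event.
    have h4 : ∑ B, ({A | α * P.optValue (q ω) ≤ P.reward A (q ω)} : Set P.actions).indicator
        (oracle (q ω)) B ≤ ENNReal.ofReal (∑ B, (S B).indicator (c B) ω) := by
      rw [ENNReal.ofReal_sum_of_nonneg]
      · refine Finset.sum_le_sum fun B _ => ?_
        by_cases hB : α * P.optValue (q ω) ≤ P.reward B (q ω)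
        · rw [Set.indicator_of_mem (show B ∈ {A | α * P.optValue (q ω) ≤ P.reward A (q ω)}
            from hB), Set.indicator_of_mem (show ω ∈ S B from ⟨hω, mem_approxOptSet hα h1 hB⟩),
            h2 B hω, ENNReal.ofReal_toReal (PMF.apply_ne_top _ _)]
        · rw [Set.indicator_of_notMem (show B ∉ {A | α * P.optValue (q ω) ≤ P.reward A (q ω)}
            from hB)]
          exact zero_le
      · intro B _
        refine Set.indicator_apply_nonneg fun _ => ?_
        rw [h2 B hω]
        exact ENNReal.toReal_nonneg
    refine (ENNReal.ofReal_le_ofReal_iff (Finset.sum_nonneg fun B _ => ?_)).1 (h3.trans h4)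
    refine Set.indicator_apply_nonneg fun _ => ?_
    rw [h2 B hω]
    exact ENNReal.toReal_nonneg
  · rw [Set.indicator_of_notMem hω]
    refine Finset.sum_nonneg fun B _ => ?_
    rw [Set.indicator_of_notMem fun hS => hω hS.1]

end SemiBandit

/-! ### Expected regret -/

namespace SemiBandit

variable {L M : ℕ} {P : SemiBandit L M} {γinf γg α β : ℝ} {Ω : Type*} {A : ℕ → Ω → P.actions}
  {X : ℕ → Ω → Fin M → Fin L → ℝ} [mΩ : MeasurableSpace Ω] {μ : Measure Ω}
  {oracle : (Fin M → Fin L → ℝ) → PMF P.actions} {T : ℕ}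

/-- The expected number of initial rounds is at most `L`. -/
theorem IsBCUCB.sum_measure_not_explored_le [IsProbabilityMeasure μ]
    (h : P.IsBCUCB μ oracle T A X) :
    ∑ t ∈ Finset.Icc 1 T, μ.real (explored A t)ᶜ ≤ L := by
  classical
  have hm : ∀ t ∈ Finset.Icc 1 T, MeasurableSet (explored A t)ᶜ := fun t ht =>
    (h.past_le (by have := (Finset.mem_Icc.1 ht).2; omega) _
      (measurableSet_explored_past t)).compl
  have hi : ∀ t ∈ Finset.Icc 1 T,
      Integrable ((explored A t)ᶜ.indicator fun _ => (1 : ℝ)) μ := fun t ht =>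
    (integrable_const 1).indicator (hm t ht)
  have heq : ∑ t ∈ Finset.Icc 1 T, μ.real (explored A t)ᶜ
      = ∫ ω, ∑ t ∈ Finset.Icc 1 T, (explored A t)ᶜ.indicator (fun _ => (1 : ℝ)) ω ∂μ := by
    rw [integral_finsetSum _ hi]
    refine Finset.sum_congr rfl fun t ht => ?_
    rw [integral_indicator (hm t ht)]
    simp
  have hinit : ∀ᵐ ω ∂μ, ∀ t ∈ Finset.Icc 1 T, (∃ j, count (fun s => A s ω) j (t - 1) = 0) →
      ∃ j, count (fun s => A s ω) j (t - 1) = 0 ∧ j ∈ (A t ω).1 := by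
    rw [Filter.eventually_all_finset]
    exact h.initial
  rw [heq]
  calc _ ≤ ∫ _, (L : ℝ) ∂μ := by
        refine integral_mono_ae (integrable_finsetSum _ hi) (integrable_const _) ?_
        filter_upwards [hinit] with ω hω
        have hcard := P.card_initial_le (fun s => A s ω) T hω
        have : ∑ t ∈ Finset.Icc 1 T, (explored A t)ᶜ.indicator (fun _ => (1 : ℝ)) ω
            = (((Finset.Icc 1 T).filter fun t =>
              ∃ j, count (fun s => A s ω) j (t - 1) = 0).card : ℝ) := by
          rw [Finset.card_filter]
          push_cast
          refine Finset.sum_congr rfl fun t _ => ?_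
          simp [Set.indicator_apply, explored]
        rw [this]
        exact_mod_cast hcard
    _ = L := by simp

/-- The regret of a single round. -/
theorem IsBCUCB.round_regret_le [IsProbabilityMeasure μ] [IsProbabilityMeasure P.law]
    (h : P.IsBCUCB μ oracle T A X)
    (hlaw : ∀ᵐ x ∂P.law, ∀ i j, x i j ∈ Set.Icc (0 : ℝ) 1) (hw : ∀ i, 0 ≤ P.w i)
    (hr : ∀ i A, ∀ x ∈ closedCube L, 0 ≤ P.r i A x)
    (hsmooth : ∀ i, MonotonicGiniSmooth (P.r i) γinf γg) (hα : 0 ≤ α) (hβ : β ≤ 1)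
    (horacle : P.IsApproxOracle α β oracle) {t : ℕ} (ht : t ∈ Finset.Icc 1 T) :
    α * β * P.rMax - ∫ ω, P.reward (A t ω) P.mean ∂μ
      ≤ P.maxGap α * μ.real (explored A t)ᶜ + P.maxGap α * μ.real (badEvent A X t)
        + ∫ ω, (oracleSuccess α A X t \ toMeasurable μ (badEvent A X t)).indicator
            (fun ω => max (P.gap α (A t ω)) 0) ω ∂μ := by
  have hp : ∀ i, P.mean i ∈ closedCube L := fun i j => mean_mem_Icc hlaw i j
  have hr0 : ∀ B, 0 ≤ P.reward B P.mean := fun B => reward_nonneg hw hr B hp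
  have hrm : 0 ≤ P.rMax := Real.iSup_nonneg hr0
  have hE : MeasurableSet (explored A t) :=
    h.past_le (by have := (Finset.mem_Icc.1 ht).2; omega) _ (measurableSet_explored_past t)
  have hF : MeasurableSet (oracleSuccess α A X t) := h.measurableSet_oracleSuccess hsmooth ht
  have hFE : oracleSuccess α A X t ⊆ explored A t := fun ω hω => hω.1
  set F := oracleSuccess α A X t with hFdef
  -- The measurable hull has the same measure as the bad event, so the decomposition needs no
  -- measurability of the latter.
  set D := toMeasurable μ (badEvent A X t) with hD
  have hDm : MeasurableSet D := measurableSet_toMeasurable _ _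
  have hG : MeasurableSet ((explored A t)ᶜ ∪ F) := hE.compl.union hF
  have hdisj : Disjoint (explored A t)ᶜ F :=
    Set.disjoint_left.2 fun ω h1 h2 => h1 (hFE h2)
  have hgapi := h.integrable_comp_batch ht (P.gap α)
  have hrewi := h.integrable_comp_batch ht fun B => P.reward B P.mean
  have hmaxi := h.integrable_comp_batch ht fun B => max (P.gap α B) 0
  have hGreal : μ.real ((explored A t)ᶜ ∪ F) = μ.real (explored A t)ᶜ + μ.real F :=
    measureReal_union hdisj hF
  have hcompl : μ.real (explored A t)ᶜ = 1 - μ.real (explored A t) := by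
    rw [measureReal_compl hE]; simp
  have hsucc : β * μ.real (explored A t) ≤ μ.real F :=
    h.le_measure_oracleSuccess hlaw hsmooth hα horacle ht
  have h1 : α * β * P.rMax ≤ α * P.rMax * μ.real ((explored A t)ᶜ ∪ F) := by
    -- P(Eᶜ) + P(F) ≥ 1 - P(E) + β P(E) ≥ β, where E is the explored event.
    have hle : β ≤ μ.real ((explored A t)ᶜ ∪ F) := by
      have h0 : 0 ≤ μ.real (explored A t)ᶜ := measureReal_nonneg
      rw [hGreal]
      nlinarith
    have := mul_le_mul_of_nonneg_left hle (mul_nonneg hα hrm)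
    linarith
  -- Since rewards are nonnegative, the outcomes where the oracle fails can be dropped.
  have h2 : ∫ ω in (explored A t)ᶜ ∪ F, P.reward (A t ω) P.mean ∂μ
      ≤ ∫ ω, P.reward (A t ω) P.mean ∂μ :=
    setIntegral_le_integral hrewi (.of_forall fun ω => hr0 _)
  have h3 : ∫ ω in (explored A t)ᶜ ∪ F, P.gap α (A t ω) ∂μ
      = α * P.rMax * μ.real ((explored A t)ᶜ ∪ F)
        - ∫ ω in (explored A t)ᶜ ∪ F, P.reward (A t ω) P.mean ∂μ := by
    simp only [gap]
    rw [integral_sub (integrable_const _) hrewi.integrableOn]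
    simp [mul_comm]
  have hmg := P.maxGap_nonneg α
  have i1 : Integrable ((explored A t)ᶜ.indicator fun _ => P.maxGap α) μ :=
    (integrable_const _).indicator hE.compl
  have i2 : Integrable (D.indicator fun _ => P.maxGap α) μ := (integrable_const _).indicator hDm
  have i3 : Integrable ((F \ D).indicator fun ω => max (P.gap α (A t ω)) 0) μ :=
    hmaxi.indicator (hF.diff hDm)
  have h4 : ∫ ω in (explored A t)ᶜ ∪ F, P.gap α (A t ω) ∂μ
      ≤ ∫ ω, ((explored A t)ᶜ.indicator (fun _ => P.maxGap α) ω
          + D.indicator (fun _ => P.maxGap α) ω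
          + (F \ D).indicator (fun ω => max (P.gap α (A t ω)) 0) ω) ∂μ := by
    rw [← integral_indicator hG]
    refine integral_mono (hgapi.indicator hG) ((i1.add i2).add i3) fun ω => ?_
    have n1 : 0 ≤ (explored A t)ᶜ.indicator (fun _ => P.maxGap α) ω :=
      Set.indicator_apply_nonneg fun _ => hmg
    have n2 : 0 ≤ D.indicator (fun _ => P.maxGap α) ω := Set.indicator_apply_nonneg fun _ => hmg
    have n3 : 0 ≤ (F \ D).indicator (fun ω => max (P.gap α (A t ω)) 0) ω :=
      Set.indicator_apply_nonneg fun _ => le_max_right _ _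
    have hle := P.gap_le_maxGap α (A t ω)
    by_cases hω : ω ∈ (explored A t)ᶜ ∪ F
    · simp only [Set.indicator_of_mem hω]
      rcases hω with hω | hω
      · rw [Set.indicator_of_mem hω]
        linarith
      · by_cases hωD : ω ∈ D
        · rw [Set.indicator_of_mem hωD]
          linarith
        · rw [Set.indicator_of_mem (show ω ∈ F \ D from ⟨hω, hωD⟩)]
          linarith [le_max_left (P.gap α (A t ω)) 0]
    · simp only [Set.indicator_of_notMem hω]
      linarith
  have i12 : Integrable (fun ω => (explored A t)ᶜ.indicator (fun _ => P.maxGap α) ω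
      + D.indicator (fun _ => P.maxGap α) ω) μ := i1.add i2
  rw [integral_add i12 i3, integral_add i1 i2, integral_indicator hE.compl,
    integral_indicator hDm] at h4
  have hDreal : μ.real D = μ.real (badEvent A X t) := by
    simp only [measureReal_def, hD, measure_toMeasurable]
  simp only [setIntegral_const, smul_eq_mul, hDreal] at h4
  linarith

theorem sum_one_div_sq_le (T : ℕ) :
    ∑ t ∈ Finset.Icc 1 T, 1 / (t : ℝ) ^ 2 ≤ Real.pi ^ 2 / 6 :=
  sum_le_hasSum _ (fun _ _ => by positivity) hasSum_zeta_two

end SemiBandit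

/-- The numerical constant of the gap-dependent term. -/
theorem confidence_const_le {K : ℕ} (hK : 2 ≤ K) :
    2 * (9 * Real.pi) ^ 2 * (3 + Real.log K) ≤ 8640 * (⌈Real.log K / 1.61⌉ : ℝ) ^ 2 := by
  have hlog : 0 < Real.log K := Real.log_pos (by exact_mod_cast hK)
  have hm : Real.log K / 1.61 ≤ (⌈Real.log K / 1.61⌉ : ℝ) := Int.le_ceil _
  have hm1 : (1 : ℝ) ≤ (⌈Real.log K / 1.61⌉ : ℝ) := by
    exact_mod_cast Int.one_le_ceil_iff.2 (by positivity)
  set m : ℝ := (⌈Real.log K / 1.61⌉ : ℝ)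
  have h1 : Real.log K ≤ 1.61 * m := by
    rw [div_le_iff₀ (by norm_num)] at hm
    linarith
  have hpi : Real.pi ^ 2 ≤ 9.9225 := by
    have := pow_le_pow_left₀ Real.pi_pos.le Real.pi_lt_d2.le 2
    norm_num at this ⊢
    exact this
  -- As m ≥ 1, one has 3 + 1.61m ≤ 4.61m². With π² ≤ 3.15² = 9.9225, the constant is 162·9.9225·4.61
  -- < 7411.
  have h2 : 3 + Real.log K ≤ 4.61 * m ^ 2 := by nlinarith
  calc 2 * (9 * Real.pi) ^ 2 * (3 + Real.log K) = 162 * Real.pi ^ 2 * (3 + Real.log K) := by ring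
    _ ≤ 162 * 9.9225 * (4.61 * m ^ 2) := by gcongr
    _ ≤ 8640 * m ^ 2 := by nlinarith [sq_nonneg m]

namespace SemiBandit

variable {L M : ℕ} {P : SemiBandit L M} {γinf γg α β : ℝ} {Ω : Type*} {A : ℕ → Ω → P.actions}
  {X : ℕ → Ω → Fin M → Fin L → ℝ} [mΩ : MeasurableSpace Ω] {μ : Measure Ω}
  {oracle : (Fin M → Fin L → ℝ) → PMF P.actions} {T : ℕ}

/-- The total gap of the successful rounds with good indices. -/
theorem sum_good_gap_le [IsProbabilityMeasure P.law]
    (hlaw : ∀ᵐ x ∂P.law, ∀ i j, x i j ∈ Set.Icc (0 : ℝ) 1) (hw : ∀ i, 0 ≤ P.w i)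
    (hsmooth : ∀ i, MonotonicGiniSmooth (P.r i) γinf γg) (hα : 0 ≤ α) {K : ℕ} (hK : 1 ≤ K)
    (hcard : ∀ A ∈ P.actions, A.card ≤ K) (ω : Ω) :
    ∑ t ∈ Finset.Icc 1 T, (oracleSuccess α A X t \ toMeasurable μ (badEvent A X t)).indicator
        (fun ω => max (P.gap α (A t ω)) 0) ω
      ≤ ∑ j ∈ P.badArms α, 2 * ((9 * Real.pi * P.totalWeight * γg) ^ 2 * Real.log T)
          / P.gapMin α j * (3 + Real.log K) := by
  classical
  set H : ℕ → Set Ω := fun t => oracleSuccess α A X t \ toMeasurable μ (badEvent A X t) with hH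
  set B := (Finset.Icc 1 T).filter fun t => ω ∈ H t ∧ 0 < P.gap α (A t ω) with hB
  have heq : ∑ t ∈ Finset.Icc 1 T, (H t).indicator (fun ω => max (P.gap α (A t ω)) 0) ω
      = ∑ t ∈ B, P.gap α (A t ω) := by
    rw [hB, Finset.sum_filter]
    refine Finset.sum_congr rfl fun t _ => ?_
    by_cases h1 : ω ∈ H t
    · rw [Set.indicator_of_mem h1]
      by_cases h2 : 0 < P.gap α (A t ω)
      · rw [if_pos ⟨h1, h2⟩, max_eq_left h2.le]
      · rw [if_neg fun h => h2 h.2, max_eq_right (not_lt.1 h2)]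
    · rw [Set.indicator_of_notMem h1, if_neg fun h => h1 h.1]
  rw [heq]
  have hmem : ∀ t ∈ B, t ∈ Finset.Icc 1 T ∧ ω ∈ H t ∧ 0 < P.gap α (A t ω) := fun t ht =>
    Finset.mem_filter.1 ht
  refine P.sum_gap_le (mul_nonneg (sq_nonneg _) (Real.log_natCast_nonneg T)) hK hcard
    (fun s => A s ω) T B (Finset.filter_subset _ _) (fun t ht => (hmem t ht).2.2)
    (fun t ht => (hmem t ht).2.1.1.1) fun t ht => ?_
  obtain ⟨h1, h2, h3⟩ := hmem t ht
  rw [Finset.mem_Icc] at h1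
  have hgood : ∀ i j, P.IsGoodIndex (fun s => A s ω) (fun s => X s ω) t i j := by
    by_contra hcon
    exact h2.2 (subset_toMeasurable μ _ ⟨h2.1.1, hcon⟩)
  exact gap_sq_le hlaw hw hsmooth hα h1.1 h1.2 hgood h2.1.2 h3

/-- The regret of BC-UCB in terms of the confidence widths. -/
theorem IsBCUCB.regret_le [IsProbabilityMeasure μ] [IsProbabilityMeasure P.law]
    (h : P.IsBCUCB μ oracle T A X)
    (hlaw : ∀ᵐ x ∂P.law, ∀ i j, x i j ∈ Set.Icc (0 : ℝ) 1) (hw : ∀ i, 0 ≤ P.w i)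
    (hr : ∀ i A, ∀ x ∈ closedCube L, 0 ≤ P.r i A x)
    (hsmooth : ∀ i, MonotonicGiniSmooth (P.r i) γinf γg) (hα : 0 ≤ α) (hβ : β ≤ 1)
    (horacle : P.IsApproxOracle α β oracle) {K : ℕ} (hK : 1 ≤ K)
    (hcard : ∀ A ∈ P.actions, A.card ≤ K) :
    P.regret μ α β A T ≤ ∑ j ∈ P.badArms α,
        2 * ((9 * Real.pi * P.totalWeight * γg) ^ 2 * Real.log T)
          / P.gapMin α j * (3 + Real.log K)
      + L * P.maxGap α * (1 + M * (2 * Real.pi ^ 2 / 3)) := by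
  set C := ∑ j ∈ P.badArms α, 2 * ((9 * Real.pi * P.totalWeight * γg) ^ 2 * Real.log T)
    / P.gapMin α j * (3 + Real.log K) with hC
  set V : ℕ → Ω → ℝ := fun t =>
    (oracleSuccess α A X t \ toMeasurable μ (badEvent A X t)).indicator
      (fun ω => max (P.gap α (A t ω)) 0) with hV
  have hVi : ∀ t ∈ Finset.Icc 1 T, Integrable (V t) μ := fun t ht =>
    (h.integrable_comp_batch ht fun B => max (P.gap α B) 0).indicator
      ((h.measurableSet_oracleSuccess hsmooth ht).diff (measurableSet_toMeasurable _ _))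
  have hmg := P.maxGap_nonneg α
  have h1 : P.regret μ α β A T = ∑ t ∈ Finset.Icc 1 T,
      (α * β * P.rMax - ∫ ω, P.reward (A t ω) P.mean ∂μ) := by
    rw [regret, Finset.sum_sub_distrib, Finset.sum_const, Nat.card_Icc, nsmul_eq_mul,
      Nat.add_sub_cancel]
    ring
  have h2 : ∑ t ∈ Finset.Icc 1 T, ∫ ω, V t ω ∂μ ≤ C := by
    rw [← integral_finsetSum _ hVi]
    calc _ ≤ ∫ _, C ∂μ := integral_mono (integrable_finsetSum _ hVi) (integrable_const _)
          fun ω => sum_good_gap_le hlaw hw hsmooth hα hK hcard ω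
      _ = C := by simp
  have h3 : ∑ t ∈ Finset.Icc 1 T, μ.real (badEvent A X t) ≤ M * L * (2 * Real.pi ^ 2 / 3) := by
    calc _ ≤ ∑ t ∈ Finset.Icc 1 T, M * L * 4 * (1 / (t : ℝ) ^ 2) := by
          refine Finset.sum_le_sum fun t ht => ?_
          refine (ENNReal.toReal_le_of_le_ofReal (by positivity)
            (h.measure_badEvent_le hlaw ht)).trans (le_of_eq ?_)
          ring
      _ ≤ M * L * 4 * (Real.pi ^ 2 / 6) := by
          rw [← Finset.mul_sum]
          exact mul_le_mul_of_nonneg_left (sum_one_div_sq_le T) (by positivity)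
      _ = _ := by ring
  have h4 := h.sum_measure_not_explored_le
  calc P.regret μ α β A T
      ≤ ∑ t ∈ Finset.Icc 1 T, (P.maxGap α * μ.real (explored A t)ᶜ
          + P.maxGap α * μ.real (badEvent A X t) + ∫ ω, V t ω ∂μ) := by
        rw [h1]
        exact Finset.sum_le_sum fun t ht =>
          h.round_regret_le hlaw hw hr hsmooth hα hβ horacle ht
    _ = P.maxGap α * ∑ t ∈ Finset.Icc 1 T, μ.real (explored A t)ᶜ
          + P.maxGap α * ∑ t ∈ Finset.Icc 1 T, μ.real (badEvent A X t)
          + ∑ t ∈ Finset.Icc 1 T, ∫ ω, V t ω ∂μ := by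
        rw [Finset.sum_add_distrib, Finset.sum_add_distrib, Finset.mul_sum, Finset.mul_sum]
    _ ≤ P.maxGap α * L + P.maxGap α * (M * L * (2 * Real.pi ^ 2 / 3)) + C := by gcongr
    _ = _ := by ring

end SemiBandit

theorem theorem1 {L M : ℕ} (P : SemiBandit L M) (K : ℕ) (γinf γg α β : ℝ)
    -- the feedback lies in `[0,1]`
    [IsProbabilityMeasure P.law]
    (hlaw : ∀ᵐ x ∂P.law, ∀ i j, x i j ∈ Set.Icc (0 : ℝ) 1)
    -- batches have size at most `K`, and every arm can be played
    (hK : 2 ≤ K) (hcard : ∀ A ∈ P.actions, A.card ≤ K)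
    (hcover : ∀ j, ∃ A ∈ P.actions, j ∈ A)
    -- the reward is a weighted sum of nonnegative monotonic Gini-smooth functions
    (hw : ∀ i, 0 ≤ P.w i)
    (hr : ∀ i A, ∀ x ∈ closedCube L, 0 ≤ P.r i A x)
    (hsmooth : ∀ i, MonotonicGiniSmooth (P.r i) γinf γg)
    -- the oracle
    (hα : α ∈ Set.Icc (0 : ℝ) 1) (hβ : β ∈ Set.Icc (0 : ℝ) 1)
    (oracle : (Fin M → Fin L → ℝ) → PMF P.actions) (horacle : P.IsApproxOracle α β oracle)
    -- `T` rounds of BC-UCB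
    (T : ℕ) (hT : 1 ≤ T)
    {Ω : Type*} [MeasurableSpace Ω] (μ : Measure Ω) [IsProbabilityMeasure μ]
    (A : ℕ → Ω → P.actions) (X : ℕ → Ω → Fin M → Fin L → ℝ)
    (hrun : P.IsBCUCB μ oracle T A X) :
    P.regret μ α β A T ≤
      (8640 * γg ^ 2 * P.totalWeight ^ 2 * ∑ j ∈ P.badArms α, 1 / P.gapMin α j
        + 340 * γinf * P.totalWeight
          * ∑ j ∈ P.badArms α, (1 + Real.log (P.gapMax α j / P.gapMin α j)))
        * (⌈Real.log K / 1.61⌉ : ℝ) ^ 2 * Real.log T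
      + L * P.maxGap α * (1 + M * (2 * Real.pi ^ 2 / 3)) := by
  have hreg := hrun.regret_le hlaw hw hr hsmooth hα.1 hβ.2 horacle (one_le_two.trans hK) hcard
  have hW : 0 ≤ P.totalWeight := Finset.sum_nonneg fun i _ => hw i
  have hlogT : 0 ≤ Real.log T := Real.log_natCast_nonneg T
  have hsum : 0 ≤ ∑ j ∈ P.badArms α, 1 / P.gapMin α j :=
    Finset.sum_nonneg fun j hj => (one_div_pos.2 (P.gapMin_pos hj)).le
  have hγ : 0 ≤ 340 * γinf * P.totalWeight
      * ∑ j ∈ P.badArms α, (1 + Real.log (P.gapMax α j / P.gapMin α j)) := by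
    rw [Finset.mul_sum]
    refine Finset.sum_nonneg fun j hj => ?_
    have h1 : 0 ≤ Real.log (P.gapMax α j / P.gapMin α j) :=
      Real.log_nonneg ((one_le_div (P.gapMin_pos hj)).2 (P.gapMin_le_gapMax hj))
    -- The sign of γinf comes from some r_i and a batch containing j. Arguing on each summand also
    -- covers M = 0, where the total weight vanishes.
    have h2 : 0 ≤ γinf * P.totalWeight := by
      rw [SemiBandit.totalWeight, Finset.mul_sum]
      obtain ⟨B, hB, hjB⟩ := hcover j
      exact Finset.sum_nonneg fun i _ => mul_nonneg
        ((hsmooth i).γinf_nonneg (A := ⟨B, hB⟩) hjB) (hw i)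
    rw [mul_assoc 340]
    positivity
  have hmain : ∑ j ∈ P.badArms α, 2 * ((9 * Real.pi * P.totalWeight * γg) ^ 2 * Real.log T)
        / P.gapMin α j * (3 + Real.log K)
      ≤ 8640 * γg ^ 2 * P.totalWeight ^ 2 * (∑ j ∈ P.badArms α, 1 / P.gapMin α j)
        * (⌈Real.log K / 1.61⌉ : ℝ) ^ 2 * Real.log T := by
    calc _ = (2 * (9 * Real.pi) ^ 2 * (3 + Real.log K)) * (γg ^ 2 * P.totalWeight ^ 2
          * (∑ j ∈ P.badArms α, 1 / P.gapMin α j) * Real.log T) := by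
          rw [Finset.mul_sum, Finset.sum_mul, Finset.mul_sum]
          exact Finset.sum_congr rfl fun j _ => by ring
      _ ≤ (8640 * (⌈Real.log K / 1.61⌉ : ℝ) ^ 2) * (γg ^ 2 * P.totalWeight ^ 2
          * (∑ j ∈ P.badArms α, 1 / P.gapMin α j) * Real.log T) :=
          mul_le_mul_of_nonneg_right (confidence_const_le hK) (by positivity)
      _ = _ := by ring
  refine hreg.trans ?_
  gcongr
  refine hmain.trans ?_
  gcongr
  linarith
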